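/- **Setting.** The class of continuous Euclidean spaces consists of all triples $(P,\mathbb{R}^d,\delta)$ with $d\ge 0$ any dimension, $P\subset\mathbb{R}^d$ finite and $\delta$ the Euclidean distance. A *distance constraint* is a pair $(p,r)\in P\times(0,\infty)$; a center $x\in\mathbb{R}^d$ *satisfies* it if $\delta(x,p)\le r$ and *$\eta$-satisfies* it if $\delta(x,p)\le(1+\eta)r$. A *ball intersection algorithm* is a deterministic algorithm $\mathcal C$ (one program for all dimensions, on a real random access machine with unit-cost operations $+,-,\times,/$ and comparisons) which, given $(P,\mathbb{R}^d)$, a finite set $Q$ of distance constraints and $\eta>0$, in time polynomial in $d$, $|P|$, $|Q|$ and $1/\eta$ either outputs a center that $\eta$-satisfies all constraints in $Q$ or fails, and which does not fail if some center satisfies all constraints in $Q$. For $\varepsilon\in(0,1)$, a *$(\mathcal C,\varepsilon)$-scattering* in $(P,\mathbb{R}^d)$ is a sequence $(x_1,p_1,r_1),\dots,(x_\ell,p_\ell,r_\ell)$, $\ell\ge1$, with $x_i\in\mathbb{R}^d$, $p_i\in P$, $r_i>0$, such that $\delta(x_i,p_i)>(1+\varepsilon)r_i$ for all $i$ and $x_i=\mathcal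 C\bigl((P,\mathbb{R}^d),\{(p_1,r_1),\dots,(p_{i-1},r_{i-1})\},\varepsilon/2\bigr)$ for all $i\ge2$ (the first center $x_1$ is arbitrary). The *$(\varepsilon,\mathcal C)$-scatter dimension* is the maximum, over all spaces of the class and all $(\mathcal C,\varepsilon)$-scatterings in them, of the number of triples with the same radius; the *algorithmic $\varepsilon$-scatter dimension* of the class is the minimum of the $(\varepsilon,\mathcal C)$-scatter dimension over all ball intersection algorithms $\mathcal C$. **Theorem.** There is an absolute constant $K>0$, independent of the dimension, such that for every $\varepsilon\in(0,1)$ the algorithmic $\varepsilon$-scatter dimension of the class of continuous Euclidean spaces is at most $K\,\varepsilon^{-4}\log(2/\varepsilon)$; that is, it is $O(\varepsilon^{-4}\log(1/\varepsilon))$ as $\varepsilon\to0$. Moreover, a single ball intersection algorithm $\mathcal C$ has $(\varepsilon,\mathcal C)$-scatter dimension at most $K\,\varepsilon^{-4}\log(2/\varepsilon)$ for all $\varepsilon\in(0,1)$ simultaneously. -/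

import Mathlib

open scoped ENNReal

noncomputable section

/-! ### A real random access machine

The machine works on three infinite arrays: `idx` holds natural numbers (addresses and counters;
directly and indirectly addressable), `reg` holds the real registers, `mem` is the real main memory,
addressed through `idx`. Programs are finite, contain only natural-number constants, and use real
arithmetic `+, -, *, /`, comparisons, branching and loops. There is no rounding operation. Every
instruction and every test costs one step. -/

namespace RealRAM

structure State where
  idx : ℕ → ℕ
  reg : ℕ → ℝ
  mem : ℕ → ℝ

inductive Instr where
  /-- `idx[a] := c` -/
  | iconst (a c : ℕ)
  /-- `idx[a] := idx[b] + idx[c]` -/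
  | iadd (a b c : ℕ)
  /-- `idx[a] := idx[b] - idx[c]` (truncated at zero) -/
  | isub (a b c : ℕ)
  /-- `idx[a] := idx[idx[b]]` -/
  | iload (a b : ℕ)
  /-- `idx[idx[a]] := idx[b]` -/
  | istore (a b : ℕ)
  /-- `reg[a] := c` -/
  | rconst (a c : ℕ)
  /-- `reg[a] := reg[b] + reg[c]` -/
  | radd (a b c : ℕ)
  /-- `reg[a] := reg[b] - reg[c]` -/
  | rsub (a b c : ℕ)
  /-- `reg[a] := reg[b] * reg[c]` -/
  | rmul (a b c : ℕ)
  /-- `reg[a] := reg[b] / reg[c]` (with result zero if `reg[c] = 0`) -/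
  | rdiv (a b c : ℕ)
  /-- `reg[a] := mem[idx[b]]` -/
  | rload (a b : ℕ)
  /-- `mem[idx[a]] := reg[b]` -/
  | rstore (a b : ℕ)

/-- The effect of one instruction. -/
def Instr.exec : Instr → State → State
  | .iconst a c, s => { s with idx := Function.update s.idx a c }
  | .iadd a b c, s => { s with idx := Function.update s.idx a (s.idx b + s.idx c) }
  | .isub a b c, s => { s with idx := Function.update s.idx a (s.idx b - s.idx c) }
  | .iload a b, s => { s with idx := Function.update s.idx a (s.idx (s.idx b)) }
  | .istore a b, s => { s with idx := Function.update s.idx (s.idx a) (s.idx b) }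
  | .rconst a c, s => { s with reg := Function.update s.reg a (c : ℝ) }
  | .radd a b c, s => { s with reg := Function.update s.reg a (s.reg b + s.reg c) }
  | .rsub a b c, s => { s with reg := Function.update s.reg a (s.reg b - s.reg c) }
  | .rmul a b c, s => { s with reg := Function.update s.reg a (s.reg b * s.reg c) }
  | .rdiv a b c, s => { s with reg := Function.update s.reg a (s.reg b / s.reg c) }
  | .rload a b, s => { s with reg := Function.update s.reg a (s.mem (s.idx b)) }
  | .rstore a b, s => { s with mem := Function.update s.mem (s.idx a) (s.reg b) }

inductive Test where
  /-- `idx[a] < idx[b]` -/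
  | ilt (a b : ℕ)
  /-- `reg[a] < reg[b]` -/
  | rlt (a b : ℕ)

def Test.Holds : Test → State → Prop
  | .ilt a b, s => s.idx a < s.idx b
  | .rlt a b, s => s.reg a < s.reg b

inductive Prog where
  | skip
  | instr (i : Instr)
  | seq (p q : Prog)
  | cond (b : Test) (p q : Prog)
  | loop (b : Test) (p : Prog)

/-- `Runs p s s' t`: started in state `s`, the program `p` halts in state `s'` after exactly
`t` steps. -/
inductive Runs : Prog → State → State → ℕ → Prop
  | skip (s : State) : Runs .skip s s 0
  | instr (i : Instr) (s : State) : Runs (.instr i) s (i.exec s) 1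
  | seq {p q : Prog} {s₁ s₂ s₃ : State} {t u : ℕ} :
      Runs p s₁ s₂ t → Runs q s₂ s₃ u → Runs (.seq p q) s₁ s₃ (t + u)
  | cond_pos {b : Test} {p q : Prog} {s s' : State} {t : ℕ} :
      b.Holds s → Runs p s s' t → Runs (.cond b p q) s s' (t + 1)
  | cond_neg {b : Test} {p q : Prog} {s s' : State} {t : ℕ} :
      ¬ b.Holds s → Runs q s s' t → Runs (.cond b p q) s s' (t + 1)
  | loop_done {b : Test} {p : Prog} {s : State} :
      ¬ b.Holds s → Runs (.loop b p) s s 1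
  | loop_step {b : Test} {p : Prog} {s₁ s₂ s₃ : State} {t u : ℕ} :
      b.Holds s₁ → Runs p s₁ s₂ t → Runs (.loop b p) s₂ s₃ u →
      Runs (.loop b p) s₁ s₃ (t + 1 + u)

end RealRAM

/-! ### Approximate ball intersection in Euclidean space -/

/-- `ℝ^d` with the Euclidean metric. -/
abbrev Euc (d : ℕ) : Type := EuclideanSpace ℝ (Fin d)

/-- `Q` is a set of distance constraints `(p, r)` with `p ∈ P` and `r > 0`; together with the space
`(P, ℝ^d)` it is an instance of the ball intersection problem. -/
def IsInstance {d : ℕ} (P : Finset (Euc d)) (Q : Finset (Euc d × ℝ)) : Prop :=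
  ∀ q ∈ Q, q.1 ∈ P ∧ 0 < q.2

/-- The initial state of the machine on the points `lP`, the constraints `lQ` and the error
parameter `η`: the sizes `d`, `|P|`, `|Q|` are in `idx[0]`, `idx[1]`, `idx[2]`, `η` is in `reg[0]`,
and `mem` holds the coordinates of the points, followed by one record (coordinates of `p`, then `r`)
for every constraint `(p, r)`. All other cells are zero. -/
def inputState {d : ℕ} (lP : List (Euc d)) (lQ : List (Euc d × ℝ)) (η : ℝ) : RealRAM.State where
  idx k := [d, lP.length, lQ.length].getD k 0
  reg k := [η].getD k 0
  mem k := (lP.flatMap (fun p => List.ofFn fun j => p j) ++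
    lQ.flatMap (fun q => (List.ofFn fun j => q.1 j) ++ [q.2])).getD k 0

/-- The result read off from a final state: "fail" (`none`) if `idx[0] = 0`, and otherwise the
center whose coordinates are `mem[0], …, mem[d-1]`. -/
def outputOf (d : ℕ) (s : RealRAM.State) : Option (Euc d) :=
  if s.idx 0 = 0 then none else some (WithLp.toLp 2 fun j : Fin d => s.mem j)

/-- The input-output behaviour of a deterministic algorithm for the class of all continuous
Euclidean spaces: from the dimension `d`, the space `(P, ℝ^d)`, the set `Q` of distance constraints
and the error parameter `η` to a center in `ℝ^d`, or `none` for "fail". -/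
abbrev CenterRule : Type :=
  (d : ℕ) → Finset (Euc d) → Finset (Euc d × ℝ) → ℝ → Option (Euc d)

/-- `C` is an (approximate) ball intersection algorithm for the class of all continuous Euclidean
spaces `(P, ℝ^d)`, `P ⊂ ℝ^d` finite, `d` arbitrary. -/
structure IsBallIntersectionAlgorithm (C : CenterRule) : Prop where
  /-- A returned center `η`-satisfies all distance constraints. -/
  sound : ∀ (d : ℕ) (P : Finset (Euc d)) (Q : Finset (Euc d × ℝ)) (η : ℝ),
    IsInstance P Q → 0 < η → ∀ x : Euc d, C d P Q η = some x →
      ∀ q ∈ Q, dist x q.1 ≤ (1 + η) * q.2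
  /-- If some center satisfies all distance constraints exactly, the algorithm does not fail. -/
  complete : ∀ (d : ℕ) (P : Finset (Euc d)) (Q : Finset (Euc d × ℝ)) (η : ℝ),
    IsInstance P Q → 0 < η → (∃ x : Euc d, ∀ q ∈ Q, dist x q.1 ≤ q.2) → C d P Q η ≠ none
  /-- One program computes `C`, however the finite sets `P` and `Q` are listed in the input, in a
  number of steps polynomial in the size of the instance and in `1 / η`. -/
  polyTime : ∃ (prog : RealRAM.Prog) (c : ℕ),
    ∀ (d : ℕ) (P : Finset (Euc d)) (Q : Finset (Euc d × ℝ)) (η : ℝ),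
      IsInstance P Q → 0 < η →
      ∀ (lP : List (Euc d)) (lQ : List (Euc d × ℝ)),
        lP.Nodup → (∀ p, p ∈ lP ↔ p ∈ P) → lQ.Nodup → (∀ q, q ∈ lQ ↔ q ∈ Q) →
        ∃ (s : RealRAM.State) (t : ℕ), RealRAM.Runs prog (inputState lP lQ η) s t ∧
          outputOf d s = C d P Q η ∧
          (t : ℝ) ≤ c * (1 + d + P.card + Q.card + 1 / η) ^ c

/-! ### Algorithmic scatter dimension -/

open Classical in
/-- The sequence `(x i, p i, r i)`, `i < ℓ`, is a `(C, ε)`-scattering in the space `(P, ℝ^d)`. The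
first center is arbitrary. -/
structure IsScattering (C : CenterRule) (ε : ℝ) {d : ℕ} (P : Finset (Euc d)) {ℓ : ℕ}
    (x p : Fin ℓ → Euc d) (r : Fin ℓ → ℝ) : Prop where
  length_pos : 0 < ℓ
  point_mem : ∀ i, p i ∈ P
  radius_pos : ∀ i, 0 < r i
  center_eq : ∀ i : Fin ℓ, 0 < (i : ℕ) →
    C d P ((Finset.univ.filter fun j => j < i).image fun j => (p j, r j)) (ε / 2) = some (x i)
  refutation : ∀ i, (1 + ε) * r i < dist (x i) (p i)

open Classical in
/-- The `(ε, C)`-scatter dimension of the class of all continuous Euclidean spaces (of all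
dimensions): the largest number of triples with the same radius in a `(C, ε)`-scattering. -/
def scatterDimOf (ε : ℝ) (C : CenterRule) : ℕ∞ :=
  sSup {n : ℕ∞ | ∃ (d : ℕ) (P : Finset (Euc d)) (ℓ : ℕ) (x p : Fin ℓ → Euc d) (r : Fin ℓ → ℝ)
    (ρ : ℝ), IsScattering C ε P x p r ∧ n = ((Finset.univ.filter fun i => r i = ρ).card : ℕ∞)}

/-- The algorithmic `ε`-scatter dimension of the class of all continuous Euclidean spaces: the
minimum of the `(ε, C)`-scatter dimension over all ball intersection algorithms `C`. -/
def algScatterDim (ε : ℝ) : ℕ∞ :=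
  ⨅ (C : CenterRule) (_ : IsBallIntersectionAlgorithm C), scatterDimOf ε C

end

/-! The rule `centerRule` realizing the bound works as follows. Let `η ≤ 1`, let `m` be the smallest
radius in `Q`, `c = 1 + η / 2`, and let the excess of a constraint `(p, r)` at `x` be
`dist x p ^ 2 - (c * r) ^ 2`. Each excess is the same quadratic form plus an affine function, so the
maximal excess over a set `A` of constraints has a minimizer `z`, and at `x` it exceeds its minimum
`v` by at least `dist x z ^ 2` (`IsBest`, `exists_isBest`). A Bădoiu–Clarkson iteration, which
averages the most violated points, comes within `B / √t` of `z` after `t` rounds, where `B` bounds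
the distances between the points and from them to `z` (`IsBest.dist_centerSeq_le`).

Points with huge radii would ruin `B`. But if a feasible center exists, all candidates
lie within `O(m)` of each other, so a ball of radius `r > 16 m / η` is satisfied up to a factor
`1 + η / 4` anyway. The iteration therefore runs on the active constraints `r ≤ 16 m / η` only,
where `B = O(m / η)`, and `O(η⁻⁴)` rounds give distance `η m / 4`, whatever the ratio of the
largest to the smallest radius. The result is then tested on all of `Q`, with factor `1 + η`
on active constraints and the stricter factor `1 + η / 4` on the others. A feasible instance passes
(`Accepted.of_feasible`). Conversely, because the radii are relaxed by `c`, on an accepted instance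
the inactive constraints have very negative excess at `z`, so that `z` and `v` are optimal for the
whole of `Q`, not only for the active part (`Accepted.exists_isBest`).

This makes `v` a potential for scatterings: it does not depend on the cutoff and can only grow with
`Q`. Consider the triples of radius `ρ` other than the first. Between two of them the output moves
by more than `ε ρ / 2`, so the exact minimizer moves by `ε ρ / 4` and `v` grows by at least
`(ε ρ / 4) ^ 2`; and `v` stays between `-9 ρ² / 4` and `O(ρ² / ε²)`. So there are `O(ε⁻⁴)` such
triples (`IsScattering.card_le`).

The rule averages over all points of maximal excess instead of picking one, hence its value depends
on the set `Q` only and a machine may traverse the constraints in the order in which they are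
listed. It uses no square roots, and `RealRAM.ballProg` computes it in polynomially many steps
(`RealRAM.reaches_ballProg`). -/

noncomputable section

/-! ### Minimizing the maximal excess -/

section Excess

variable {E : Type*} [NormedAddCommGroup E] [InnerProductSpace ℝ E]

/-- The power of `x` with respect to the ball of center `q.1` and radius `c * q.2`; if
`c * q.2` is nonnegative, it is at most zero exactly in that ball. -/
def excess (c : ℝ) (q : E × ℝ) (x : E) : ℝ := dist x q.1 ^ 2 - (c * q.2) ^ 2

/-- `z` minimizes the maximal excess over `A`, with minimum `v`. The second field is the quadratic
growth of the maximal excess away from its minimizer, and implies `A.Nonempty`. -/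
structure IsBest (c : ℝ) (A : Finset (E × ℝ)) (z : E) (v : ℝ) : Prop where
  le : ∀ q ∈ A, excess c q z ≤ v
  growth : ∀ x, ∃ q ∈ A, v + dist x z ^ 2 ≤ excess c q x

omit [InnerProductSpace ℝ E] in
/-- The minimum grows with the set of constraints, by at least the squared displacement of the
minimizer. -/
lemma IsBest.mono {c : ℝ} {A B : Finset (E × ℝ)} {z w : E} {u v : ℝ} (hA : IsBest c A z u)
    (hB : IsBest c B w v) (h : A ⊆ B) : u + dist w z ^ 2 ≤ v := by
  obtain ⟨q, hq, hle⟩ := hA.growth w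
  exact hle.trans (hB.le q (h hq))

lemma excess_lineMap (c : ℝ) (q : E × ℝ) (x z : E) (t : ℝ) :
    excess c q (z + t • (x - z)) =
      (1 - t) * excess c q z + t * excess c q x - t * (1 - t) * dist x z ^ 2 := by
  have e1 : z + t • (x - z) - q.1 = (z - q.1) + t • (x - z) := by abel
  have e2 : x - q.1 = (z - q.1) + (x - z) := by abel
  simp only [excess, dist_eq_norm]
  rw [e1, e2, norm_add_sq_real, norm_add_sq_real, norm_smul, inner_smul_right, mul_pow,
    Real.norm_eq_abs, sq_abs]
  ring

lemma exists_isBest [ProperSpace E] (c : ℝ) {A : Finset (E × ℝ)} (hA : A.Nonempty) :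
    ∃ z v, IsBest c A z v := by
  set g : E → ℝ := fun x => A.sup' hA fun q => excess c q x
  have hcont : Continuous g := by
    refine Continuous.finset_sup'_apply hA fun q _ => ?_
    unfold excess
    fun_prop
  obtain ⟨q₀, hq₀⟩ := hA
  have hlim : Filter.Tendsto g (Filter.cocompact E) Filter.atTop := by
    have h1 : Filter.Tendsto (fun x : E => excess c q₀ x) (Filter.cocompact E) Filter.atTop := by
      unfold excess
      refine Filter.tendsto_atTop_add_const_right _ _ ?_
      exact (Filter.tendsto_pow_atTop two_ne_zero).comp (tendsto_dist_right_cocompact_atTop q₀.1)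
    refine Filter.tendsto_atTop_mono (fun x => ?_) h1
    exact Finset.le_sup' (fun q => excess c q x) hq₀
  obtain ⟨z, hz⟩ := hcont.exists_forall_le hlim
  refine ⟨z, g z, fun q hq => Finset.le_sup' (fun q => excess c q z) hq, fun x => ?_⟩
  obtain ⟨q, hq, hqx⟩ := Finset.exists_mem_eq_sup' ⟨q₀, hq₀⟩ fun q => excess c q x
  refine ⟨q, hq, ?_⟩
  rw [← hqx]
  -- Moving from `z` towards `x` by a fraction `t` cannot decrease the maximum; let `t → 0`.
  have key : ∀ t : ℝ, 0 < t → t < 1 → g z + (1 - t) * dist x z ^ 2 ≤ g x := by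
    intro t ht0 ht1
    have h1 : g (z + t • (x - z)) ≤ (1 - t) * g z + t * g x - t * (1 - t) * dist x z ^ 2 := by
      refine Finset.sup'_le _ _ fun p hp => ?_
      rw [excess_lineMap]
      have a1 : excess c p z ≤ g z := Finset.le_sup' (fun q => excess c q z) hp
      have a2 : excess c p x ≤ g x := Finset.le_sup' (fun q => excess c q x) hp
      have := mul_le_mul_of_nonneg_left a1 (by linarith : 0 ≤ 1 - t)
      have := mul_le_mul_of_nonneg_left a2 ht0.le
      linarith
    have h2 := (hz (z + t • (x - z))).trans h1
    have h3 : 0 ≤ t * (g x - g z - (1 - t) * dist x z ^ 2) := by linarith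
    linarith [nonneg_of_mul_nonneg_right h3 ht0]
  have hl : Filter.Tendsto (fun t : ℝ => g z + (1 - t) * dist x z ^ 2) (nhdsWithin 0 (Set.Ioi 0))
      (nhds (g z + (1 - 0) * dist x z ^ 2)) := by
    refine Filter.Tendsto.mono_left ?_ nhdsWithin_le_nhds
    exact Continuous.tendsto (by fun_prop) 0
  have := le_of_tendsto hl (by
    filter_upwards [Ioo_mem_nhdsGT (show (0 : ℝ) < 1 by norm_num)] with t ht
    exact key t ht.1 ht.2)
  simpa using this

open Classical in
/-- The constraints in `A` of maximal excess at `x`. -/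
def farthest (c : ℝ) (A : Finset (E × ℝ)) (x : E) : Finset (E × ℝ) :=
  A.filter fun q => ∀ p ∈ A, excess c p x ≤ excess c q x

/-- The average of the points of maximal excess at `x`. Averaging, rather than choosing one of them,
keeps the iteration independent of any order on `A`. It is `0` if `A` is empty. -/
def target (c : ℝ) (A : Finset (E × ℝ)) (x : E) : E :=
  ((farthest c A x).card : ℝ)⁻¹ • ∑ q ∈ farthest c A x, q.1

/-- The Bădoiu–Clarkson iteration: each center is the average of the targets seen so far. The
initial center `0` has weight `0` and only influences the first target. -/
def centerSeq (c : ℝ) (A : Finset (E × ℝ)) : ℕ → E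
  | 0 => 0
  | t + 1 => ((t : ℝ) + 1)⁻¹ • ((t : ℝ) • centerSeq c A t + target c A (centerSeq c A t))

omit [InnerProductSpace ℝ E] in
lemma farthest_nonempty (c : ℝ) {A : Finset (E × ℝ)} (hA : A.Nonempty) (x : E) :
    (farthest c A x).Nonempty := by
  obtain ⟨q, hq, h⟩ := A.exists_max_image (fun q => excess c q x) hA
  exact ⟨q, by classical simpa [farthest] using ⟨hq, fun a b hp => h (a, b) hp⟩⟩

omit [InnerProductSpace ℝ E] in
lemma farthest_subset (c : ℝ) (A : Finset (E × ℝ)) (x : E) : farthest c A x ⊆ A :=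
  Finset.filter_subset _ _

lemma target_mem {c : ℝ} {A : Finset (E × ℝ)} (hA : A.Nonempty) (x : E) {s : Set E}
    (hs : Convex ℝ s) (h : ∀ q ∈ farthest c A x, q.1 ∈ s) : target c A x ∈ s := by
  have hF := farthest_nonempty c hA x
  have h0 : ((farthest c A x).card : ℝ) ≠ 0 := by exact_mod_cast hF.card_ne_zero
  rw [target, Finset.smul_sum]
  exact hs.sum_mem (fun _ _ => by positivity) (by simp [h0]) h

lemma centerSeq_mem {c : ℝ} {A : Finset (E × ℝ)} (hA : A.Nonempty) {s : Set E}
    (hs : Convex ℝ s) (h : ∀ q ∈ A, q.1 ∈ s) (t : ℕ) : centerSeq c A (t + 1) ∈ s := by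
  have hT : ∀ x, target c A x ∈ s := fun x =>
    target_mem hA x hs fun q hq => h q (farthest_subset c A x hq)
  induction t with
  | zero => simpa [centerSeq] using hT 0
  | succ t ih =>
    rw [centerSeq, smul_add, smul_smul]
    have h0 : ((t + 1 : ℕ) : ℝ) + 1 ≠ 0 := by positivity
    refine hs ih (hT _) (by positivity) (by positivity) ?_
    field_simp

/-- The direction from `x` to its target makes progress towards the minimizer. For a single point of
maximal excess this is strong convexity; the condition on the point is an affine inequality, so it
passes to averages. -/
lemma IsBest.le_inner_target {c : ℝ} {A : Finset (E × ℝ)} {z : E} {v : ℝ} (h : IsBest c A z v)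
    (x : E) : dist x z ^ 2 ≤ inner ℝ (x - z) (x - target c A x) := by
  obtain ⟨p, hp, hpx⟩ := h.growth x
  refine target_mem (s := {y | dist x z ^ 2 ≤ inner ℝ (x - z) (x - y)}) ⟨p, hp⟩ x ?_ ?_
  · intro y hy w hw a b ha hb hab
    simp only [Set.mem_ofPred_eq] at *
    have e : x - (a • y + b • w) = a • (x - y) + b • (x - w) := by
      rw [smul_sub, smul_sub, sub_add_sub_comm, ← add_smul, hab, one_smul]
    rw [e, inner_add_right, inner_smul_right, inner_smul_right]
    nlinarith [mul_le_mul_of_nonneg_left hy ha, mul_le_mul_of_nonneg_left hw hb,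
      congrArg (· * dist x z ^ 2) hab]
  · intro q hq
    obtain ⟨hqA, hmax⟩ := Finset.mem_filter.1 hq
    have h1 := h.le q hqA
    have h2 := hpx.trans (hmax p hp)
    have e : z - q.1 = (x - q.1) - (x - z) := by abel
    simp only [excess, dist_eq_norm] at h1 h2
    rw [e, norm_sub_sq_real, real_inner_comm] at h1
    simp only [Set.mem_ofPred_eq, dist_eq_norm]
    linarith

/-- After `t` rounds the center is within `B / √t` of the minimizer. -/
lemma IsBest.dist_centerSeq_le {c : ℝ} {A : Finset (E × ℝ)} {z : E} {v B : ℝ}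
    (h : IsBest c A z v) (hB : ∀ p ∈ A, ∀ q ∈ A, dist p.1 q.1 ≤ B) (hz : ∀ p ∈ A, dist p.1 z ≤ B)
    (t : ℕ) : t * dist (centerSeq c A t) z ^ 2 ≤ B ^ 2 := by
  have hA : A.Nonempty := let ⟨q, hq, _⟩ := h.growth 0; ⟨q, hq⟩
  have hT : ∀ w : E, (∀ p ∈ A, dist p.1 w ≤ B) → ∀ x, dist (target c A x) w ≤ B := fun w hw x =>
    Metric.mem_closedBall.1 <| target_mem hA x (convex_closedBall w B) fun q hq =>
      Metric.mem_closedBall.2 (hw q (farthest_subset c A x hq))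
  have hX : ∀ p ∈ A, ∀ t, dist (centerSeq c A (t + 1)) p.1 ≤ B := fun p hp t =>
    Metric.mem_closedBall.1 <| centerSeq_mem hA (convex_closedBall p.1 B) (fun q hq =>
      Metric.mem_closedBall.2 (hB q hq p hp)) t
  rcases t with _ | t
  · simpa using sq_nonneg B
  induction t with
  | zero =>
    have h1 : centerSeq c A (0 + 1) = target c A 0 := by simp [centerSeq]
    rw [h1]
    simpa using pow_le_pow_left₀ dist_nonneg (hT z hz 0) 2
  | succ t ih =>
    set x := centerSeq c A (t + 1) with hx
    have h1 : ‖x - target c A x‖ ≤ B := by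
      rw [← dist_eq_norm, dist_comm]
      exact hT x (fun p hp => by rw [dist_comm]; exact hX p hp t) x
    have h2 := h.le_inner_target x
    have h0 : ((t + 1 : ℕ) : ℝ) + 1 ≠ 0 := by positivity
    set τ : ℝ := ((t + 1 : ℕ) : ℝ) with hτ
    have hτ0 : 0 ≤ τ := by positivity
    have e : (τ + 1) • (centerSeq c A (t + 1 + 1) - z) =
        (τ + 1) • (x - z) - (x - target c A x) := by
      rw [centerSeq, ← hx, ← hτ, smul_sub, smul_smul, mul_inv_cancel₀ h0]
      module
    have e2 := congrArg (fun y => ‖y‖ ^ 2) e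
    simp only [norm_smul, mul_pow, norm_sub_sq_real ((τ + 1) • (x - z)), inner_smul_left,
      Real.norm_eq_abs, sq_abs] at e2
    simp only [dist_eq_norm] at h2 ih ⊢
    have h3 : ‖x - target c A x‖ ^ 2 ≤ B ^ 2 := pow_le_pow_left₀ (norm_nonneg _) h1 2
    have hc : (((t + 1 + 1 : ℕ)) : ℝ) = τ + 1 := by rw [hτ]; push_cast; ring
    rw [hc]
    simp only [conj_trivial] at e2
    have h4 : (τ + 1) * ‖x - z‖ ^ 2 ≤ (τ + 1) * inner ℝ (x - z) (x - target c A x) :=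
      mul_le_mul_of_nonneg_left h2 (by linarith)
    have h5 : τ * (τ * ‖x - z‖ ^ 2) ≤ τ * B ^ 2 := mul_le_mul_of_nonneg_left ih hτ0
    have h6 : (τ + 1) * ((τ + 1) * ‖centerSeq c A (t + 1 + 1) - z‖ ^ 2) ≤ (τ + 1) * B ^ 2 := by
      nlinarith [sq_nonneg ‖x - z‖]
    exact le_of_mul_le_mul_left h6 (by linarith)

end Excess

/-! ### The center rule -/

section Rule

variable {E : Type*} [NormedAddCommGroup E] [InnerProductSpace ℝ E]

/-- The smallest radius in `Q`; it is `0` if `Q` is empty. -/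
def minRadius (Q : Finset (E × ℝ)) : ℝ := sInf (Prod.snd '' (Q : Set (E × ℝ)))

omit [NormedAddCommGroup E] [InnerProductSpace ℝ E] in
lemma minRadius_le {Q : Finset (E × ℝ)} {q : E × ℝ} (hq : q ∈ Q) : minRadius Q ≤ q.2 :=
  csInf_le (Q.finite_toSet.image _).bddBelow ⟨q, hq, rfl⟩

omit [NormedAddCommGroup E] [InnerProductSpace ℝ E] in
lemma exists_eq_minRadius {Q : Finset (E × ℝ)} (hQ : Q.Nonempty) :
    ∃ q ∈ Q, q.2 = minRadius Q := by
  have : minRadius Q ∈ Prod.snd '' (Q : Set (E × ℝ)) :=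
    (hQ.to_set.image _).csInf_mem (Q.finite_toSet.image _)
  obtain ⟨q, hq, h⟩ := this
  exact ⟨q, hq, h⟩

/-- The largest radius that a constraint may have to take part in the iteration. -/
def cutoff (η : ℝ) (Q : Finset (E × ℝ)) : ℝ := 16 * minRadius Q / η

/-- The constraints that take part in the iteration. -/
def active (η : ℝ) (Q : Finset (E × ℝ)) : Finset (E × ℝ) := Q.filter fun q => q.2 ≤ cutoff η Q

/-- The center proposed for `Q`, an approximate minimizer of the maximal excess. -/
def approxCenter (η : ℝ) (Q : Finset (E × ℝ)) : E :=
  centerSeq (1 + η / 2) (active η Q) ⌈65536 / η ^ 4⌉₊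

/-- The final test. Inactive constraints must hold with the smaller error `η / 4`, which leaves a
margin to the radius `(1 + η / 2) * q.2` of the excess. Distances are squared because the machine has
no square roots. -/
def Accepted (η : ℝ) (Q : Finset (E × ℝ)) (x : E) : Prop :=
  ∀ q ∈ Q, dist x q.1 ^ 2 ≤ ((if q.2 ≤ cutoff η Q then 1 + η else 1 + η / 4) * q.2) ^ 2

omit [InnerProductSpace ℝ E] in
lemma Accepted.dist_le {η : ℝ} {Q : Finset (E × ℝ)} {x : E} (h : Accepted η Q x) (hη : 0 < η)
    {q : E × ℝ} (hq : q ∈ Q) (hr : 0 < q.2) :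
    dist x q.1 ≤ (if q.2 ≤ cutoff η Q then 1 + η else 1 + η / 4) * q.2 := by
  refine (sq_le_sq₀ dist_nonneg ?_).1 (h q hq)
  split_ifs <;> positivity

omit [NormedAddCommGroup E] [InnerProductSpace ℝ E] in
lemma minRadius_pos {Q : Finset (E × ℝ)} (hQ : Q.Nonempty) (hr : ∀ q ∈ Q, 0 < q.2) :
    0 < minRadius Q := by
  obtain ⟨q, hq, h⟩ := exists_eq_minRadius hQ
  exact h ▸ hr q hq

omit [NormedAddCommGroup E] [InnerProductSpace ℝ E] in
lemma exists_active {η : ℝ} (hη : 0 < η) (hη1 : η ≤ 1) {Q : Finset (E × ℝ)} (hQ : Q.Nonempty)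
    (hr : ∀ q ∈ Q, 0 < q.2) : ∃ q ∈ active η Q, q.2 = minRadius Q := by
  obtain ⟨q, hq, h⟩ := exists_eq_minRadius hQ
  refine ⟨q, Finset.mem_filter.2 ⟨hq, ?_⟩, h⟩
  have := minRadius_pos hQ hr
  rw [h, cutoff, le_div_iff₀ hη]
  nlinarith

/-- The number of rounds suffices as soon as some `y` lies within twice the radius of every active
point, for then the active points and `z` have mutual distances at most four times the cutoff. -/
lemma IsBest.dist_approxCenter_le {η : ℝ} (hη : 0 < η) (hη1 : η ≤ 1) {Q : Finset (E × ℝ)}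
    (hr : ∀ q ∈ Q, 0 < q.2) {z y : E} {v : ℝ} (h : IsBest (1 + η / 2) (active η Q) z v)
    (hy : ∀ q ∈ active η Q, dist y q.1 ≤ 2 * q.2) :
    v ≤ 4 * cutoff η Q ^ 2 ∧ dist (approxCenter η Q) z ≤ η / 4 * minRadius Q := by
  obtain ⟨q₀, hq₀, hq₀y⟩ := h.growth y
  have hm : 0 < minRadius Q := minRadius_pos ⟨q₀, (Finset.mem_filter.1 hq₀).1⟩ hr
  have hM : 0 < cutoff η Q := by unfold cutoff; positivity
  have hA : ∀ q ∈ active η Q, 0 < q.2 ∧ q.2 ≤ cutoff η Q := fun q hq =>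
    ⟨hr q (Finset.mem_filter.1 hq).1, (Finset.mem_filter.1 hq).2⟩
  set M := cutoff η Q with hMdef
  have hy2 : ∀ q ∈ active η Q, dist y q.1 ≤ 2 * M := fun q hq =>
    (hy q hq).trans (by linarith [(hA q hq).2])
  have hv : v ≤ 4 * M ^ 2 := by
    have h1 := pow_le_pow_left₀ dist_nonneg (hy2 q₀ hq₀) 2
    unfold excess at hq₀y
    nlinarith [sq_nonneg (dist y z), sq_nonneg ((1 + η / 2) * q₀.2)]
  refine ⟨hv, ?_⟩
  have hpq : ∀ p ∈ active η Q, ∀ q ∈ active η Q, dist p.1 q.1 ≤ 4 * M := fun p hp q hq => by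
    linarith [dist_triangle_left p.1 q.1 y, hy2 p hp, hy2 q hq]
  have hz : ∀ p ∈ active η Q, dist p.1 z ≤ 4 * M := fun p hp => by
    have h1 := h.le p hp
    obtain ⟨h2, h3⟩ := hA p hp
    rw [dist_comm]
    refine abs_le_of_sq_le_sq' ?_ (by positivity) |>.2
    unfold excess at h1
    have h4 : ((1 + η / 2) * p.2) ^ 2 ≤ (2 * M) ^ 2 :=
      pow_le_pow_left₀ (by positivity) (mul_le_mul (by linarith) h3 h2.le (by norm_num)) 2
    nlinarith [sq_nonneg M]
  have h1 := h.dist_centerSeq_le hpq hz ⌈65536 / η ^ 4⌉₊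
  change _ * dist (approxCenter η Q) z ^ 2 ≤ _ at h1
  have h2 : 65536 / η ^ 4 * dist (approxCenter η Q) z ^ 2 ≤ (4 * M) ^ 2 :=
    (mul_le_mul_of_nonneg_right (Nat.le_ceil _) (sq_nonneg _)).trans h1
  refine abs_le_of_sq_le_sq' ?_ (by positivity) |>.2
  have h3 : (4 * M) ^ 2 = 65536 / η ^ 4 * (η / 4 * minRadius Q) ^ 2 := by
    rw [hMdef, cutoff]
    field_simp
    norm_num
  rw [h3] at h2
  exact le_of_mul_le_mul_left h2 (by positivity)

lemma Accepted.of_feasible [ProperSpace E] {η : ℝ} (hη : 0 < η) (hη1 : η ≤ 1)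
    {Q : Finset (E × ℝ)} (hr : ∀ q ∈ Q, 0 < q.2) {y : E} (hy : ∀ q ∈ Q, dist y q.1 ≤ q.2) :
    Accepted η Q (approxCenter η Q) := by
  intro q hq
  obtain ⟨q₀, hq₀, hq₀m⟩ := exists_active hη hη1 ⟨q, hq⟩ hr
  obtain ⟨z, v, h⟩ := exists_isBest (1 + η / 2) ⟨q₀, hq₀⟩
  have hsub : ∀ p ∈ active η Q, p ∈ Q := fun p hp => (Finset.mem_filter.1 hp).1
  have hnear := (h.dist_approxCenter_le hη hη1 hr (y := y) fun p hp => by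
    linarith [hy p (hsub p hp), hr p (hsub p hp)]).2
  have hm := minRadius_pos ⟨q, hq⟩ hr
  have hv : v ≤ 0 := by
    obtain ⟨p, hp, hle⟩ := h.growth y
    have h1 := hy p (hsub p hp)
    have h2 := hr p (hsub p hp)
    have h3 : dist y p.1 ^ 2 ≤ ((1 + η / 2) * p.2) ^ 2 :=
      pow_le_pow_left₀ dist_nonneg (by nlinarith) 2
    unfold excess at hle
    nlinarith [sq_nonneg (dist y z)]
  have hx : ∀ p ∈ active η Q,
      dist (approxCenter η Q) p.1 ≤ (1 + η / 2) * p.2 + η / 4 * minRadius Q := fun p hp => by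
    have h1 := h.le p hp
    have h2 := hr p (hsub p hp)
    have h3 : dist z p.1 ≤ (1 + η / 2) * p.2 := by
      refine abs_le_of_sq_le_sq' ?_ (by positivity) |>.2
      unfold excess at h1
      linarith
    linarith [dist_triangle (approxCenter η Q) z p.1]
  refine pow_le_pow_left₀ dist_nonneg ?_ 2
  split_ifs with hc
  · have h1 := hx q (Finset.mem_filter.2 ⟨hq, hc⟩)
    nlinarith [minRadius_le hq, hr q hq]
  · have h1 := hx q₀ hq₀
    have h2 := hy q₀ (hsub q₀ hq₀)
    have h3 := hy q hq
    rw [not_le, cutoff, div_lt_iff₀ hη] at hc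
    rw [hq₀m] at h1 h2
    have h4 := dist_triangle4 (approxCenter η Q) q₀.1 y q.1
    rw [dist_comm q₀.1 y] at h4
    nlinarith

/-- On an accepted instance the proposed center is close to the minimizer for all of `Q`. -/
lemma Accepted.exists_isBest [ProperSpace E] {η : ℝ} (hη : 0 < η) (hη1 : η ≤ 1)
    {Q : Finset (E × ℝ)} (hQ : Q.Nonempty) (hr : ∀ q ∈ Q, 0 < q.2)
    (h : Accepted η Q (approxCenter η Q)) :
    ∃ z v, IsBest (1 + η / 2) Q z v ∧ v ≤ 4 * cutoff η Q ^ 2 ∧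
      dist (approxCenter η Q) z ≤ η / 4 * minRadius Q := by
  obtain ⟨q₀, hq₀, hq₀m⟩ := exists_active hη hη1 hQ hr
  obtain ⟨z, v, hb⟩ := _root_.exists_isBest (1 + η / 2) ⟨q₀, hq₀⟩
  have hsub : ∀ p ∈ active η Q, p ∈ Q := fun p hp => (Finset.mem_filter.1 hp).1
  obtain ⟨hv, hnear⟩ := hb.dist_approxCenter_le hη hη1 hr (y := approxCenter η Q) fun p hp => by
    have h1 := h.dist_le hη (hsub p hp) (hr p (hsub p hp))
    rw [if_pos (Finset.mem_filter.1 hp).2] at h1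
    nlinarith [hr p (hsub p hp)]
  refine ⟨z, v, ⟨fun q hq => ?_, fun x => ?_⟩, hv, hnear⟩
  · by_cases hc : q.2 ≤ cutoff η Q
    · exact hb.le q (Finset.mem_filter.2 ⟨hq, hc⟩)
    -- A large ball contains `z` with so much room that its excess is below that of the
    -- smallest ball.
    have h1 := h.dist_le hη hq (hr q hq)
    rw [if_neg hc] at h1
    have hm := minRadius_pos hQ hr
    have h2 := hb.le q₀ hq₀
    refine le_trans ?_ h2
    have h3 : dist z q.1 ≤ (1 + η / 4) * q.2 + η / 4 * minRadius Q := by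
      linarith [dist_triangle_left z q.1 (approxCenter η Q)]
    have h4 := pow_le_pow_left₀ dist_nonneg h3 2
    rw [not_le, cutoff, div_lt_iff₀ hη] at hc
    unfold excess
    rw [hq₀m]
    have h5 : 16 * minRadius Q < q.2 := by nlinarith [hr q hq]
    have h6 : ((1 + η / 2) * minRadius Q) ^ 2 ≤ (3 / 2 * minRadius Q) ^ 2 :=
      pow_le_pow_left₀ (by positivity) (by nlinarith) 2
    have h7 : 3 * minRadius Q ≤ η / 4 * q.2 - η / 4 * minRadius Q := by nlinarith
    have h8 : 3 * minRadius Q * (3 * minRadius Q) ≤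
        (η / 4 * q.2 - η / 4 * minRadius Q) *
          ((1 + η / 2) * q.2 + ((1 + η / 4) * q.2 + η / 4 * minRadius Q)) :=
      mul_le_mul h7 (by nlinarith) (by positivity) (by linarith)
    nlinarith [sq_nonneg (dist z q₀.1)]
  · obtain ⟨p, hp, hle⟩ := hb.growth x
    exact ⟨p, hsub p hp, hle⟩

open Classical in
/-- The ball intersection rule. It ignores `P`. An error parameter above `1` is lowered to `1`. -/
def centerRule : CenterRule := fun _ _ Q η =>
  if Accepted (min η 1) Q (approxCenter (min η 1) Q) then some (approxCenter (min η 1) Q) else none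

lemma centerRule_eq_some {d : ℕ} {P : Finset (Euc d)} {Q : Finset (Euc d × ℝ)} {η : ℝ}
    {x : Euc d} : centerRule d P Q η = some x ↔
      Accepted (min η 1) Q (approxCenter (min η 1) Q) ∧ approxCenter (min η 1) Q = x := by
  unfold centerRule
  split_ifs with h <;> simp [h]

lemma centerRule_sound {d : ℕ} {P : Finset (Euc d)} {Q : Finset (Euc d × ℝ)} {η : ℝ}
    (hη : 0 < η) (hr : ∀ q ∈ Q, 0 < q.2) {x : Euc d} (h : centerRule d P Q η = some x) :
    ∀ q ∈ Q, dist x q.1 ≤ (1 + η) * q.2 := by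
  obtain ⟨hacc, rfl⟩ := centerRule_eq_some.1 h
  intro q hq
  refine (hacc.dist_le (lt_min hη one_pos) hq (hr q hq)).trans
    (mul_le_mul_of_nonneg_right ?_ (hr q hq).le)
  have := min_le_left η 1
  split_ifs <;> linarith

lemma centerRule_complete {d : ℕ} {P : Finset (Euc d)} {Q : Finset (Euc d × ℝ)} {η : ℝ}
    (hη : 0 < η) (hr : ∀ q ∈ Q, 0 < q.2) (h : ∃ y : Euc d, ∀ q ∈ Q, dist y q.1 ≤ q.2) :
    centerRule d P Q η ≠ none := by
  obtain ⟨y, hy⟩ := h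
  unfold centerRule
  rw [if_pos (Accepted.of_feasible (lt_min hη one_pos) (min_le_right _ _) hr hy)]
  simp

end Rule

/-! ### Counting the triples of one radius -/

section Scattering

/-- A function that increases by at least `δ` between any two elements of `S` attains a value at least
`(S.card - 1) * δ` above its lower bound. -/
lemma exists_card_mul_le {ι : Type*} [LinearOrder ι] (V : ι → ℝ) {a δ : ℝ} (S : Finset ι)
    (ha : ∀ i ∈ S, a ≤ V i) (hδ : ∀ i ∈ S, ∀ j ∈ S, i < j → V i + δ ≤ V j) (hS : S.Nonempty) :
    ∃ i ∈ S, a + ((S.card : ℝ) - 1) * δ ≤ V i := by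
  induction S using Finset.induction_on_max with
  | empty => simp at hS
  | insert m S hm ih =>
    rcases S.eq_empty_or_nonempty with rfl | hne
    · exact ⟨m, by simp, by simpa using ha m (by simp)⟩
    · obtain ⟨i, hi, hle⟩ := ih (fun i hi => ha i (by simp [hi]))
        (fun i hi j hj => hδ i (by simp [hi]) j (by simp [hj])) hne
      refine ⟨m, by simp, ?_⟩
      have := hδ i (by simp [hi]) m (by simp) (hm i hi)
      rw [Finset.card_insert_of_notMem fun h => lt_irrefl m (hm m h)]
      push_cast
      linarith

open Classical in
lemma IsScattering.card_le {ε : ℝ} (hε : 0 < ε) (hε1 : ε < 1) {d : ℕ} {P : Finset (Euc d)}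
    {ℓ : ℕ} {x p : Fin ℓ → Euc d} {r : Fin ℓ → ℝ} (h : IsScattering centerRule ε P x p r)
    (ρ : ℝ) : ((Finset.univ.filter fun i => r i = ρ).card : ℝ) ≤ 70000 * (1 / ε) ^ 4 := by
  set S := Finset.univ.filter fun i => r i = ρ
  have hone : (1 : ℝ) ≤ (1 / ε) ^ 4 := one_le_pow₀ ((one_le_div hε).2 hε1.le)
  rcases S.eq_empty_or_nonempty with h0 | hne
  · rw [h0]; simp; positivity
  set i₀ := S.min' hne with hi₀
  have hi₀S : i₀ ∈ S := S.min'_mem hne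
  have hrS : ∀ i ∈ S, r i = ρ := fun i hi => (Finset.mem_filter.1 hi).2
  have hρ : 0 < ρ := hrS i₀ hi₀S ▸ h.radius_pos i₀
  rcases (S.erase i₀).eq_empty_or_nonempty with h0 | hne'
  · have h1 := Finset.card_erase_add_one hi₀S
    rw [h0] at h1
    rw [← h1, Finset.card_empty, zero_add, Nat.cast_one]
    linarith
  set Q : Fin ℓ → Finset (Euc d × ℝ) := fun i =>
    (Finset.univ.filter fun j => j < i).image fun j => (p j, r j)
  have hmem : ∀ i j, j < i → (p j, r j) ∈ Q i := fun i j hj =>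
    Finset.mem_image.2 ⟨j, by simpa using hj, rfl⟩
  have hpos : ∀ i, ∀ q ∈ Q i, 0 < q.2 := fun i q hq => by
    obtain ⟨j, -, rfl⟩ := Finset.mem_image.1 hq
    exact h.radius_pos j
  have hmono : ∀ i j, i < j → Q i ⊆ Q j := fun i j hij =>
    Finset.image_subset_image fun k hk => by
      simp only [Finset.mem_filter, Finset.mem_univ, true_and] at hk ⊢
      exact hk.trans hij
  have hlt : ∀ i ∈ S.erase i₀, i₀ < i := fun i hi =>
    lt_of_le_of_ne (S.min'_le i (Finset.mem_of_mem_erase hi)) (Finset.ne_of_mem_erase hi).symm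
  set η := ε / 2 with hη
  have hη0 : 0 < η := by positivity
  have hη1 : η ≤ 1 := by rw [hη]; linarith
  have hsome : ∀ i ∈ S.erase i₀, centerRule d P (Q i) η = some (x i) := fun i hi =>
    h.center_eq i (lt_of_le_of_lt (Nat.zero_le _) (hlt i hi))
  have hbest : ∀ i, i ∈ S.erase i₀ → ∃ (z : Euc d) (v : ℝ), IsBest (1 + η / 2) (Q i) z v ∧
      v ≤ 1024 * ρ ^ 2 / η ^ 2 ∧ dist (x i) z ≤ η / 4 * ρ := fun i hi => by
    have h1 := hmem i i₀ (hlt i hi)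
    obtain ⟨hacc, hx⟩ := centerRule_eq_some.1 (hsome i hi)
    rw [min_eq_left hη1] at hacc hx
    obtain ⟨z, v, hb, hv, hd⟩ := hacc.exists_isBest hη0 hη1 ⟨_, h1⟩ (hpos i)
    have hm : minRadius (Q i) ≤ ρ := (minRadius_le h1).trans (hrS i₀ hi₀S).le
    have hm0 := minRadius_pos ⟨_, h1⟩ (hpos i)
    refine ⟨z, v, hb, hv.trans ?_, ?_⟩
    · rw [cutoff, div_pow, mul_pow, ← mul_div_assoc]
      refine div_le_div_of_nonneg_right ?_ (by positivity)
      nlinarith [pow_le_pow_left₀ hm0.le hm 2]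
    · rw [← hx]
      exact hd.trans (mul_le_mul_of_nonneg_left hm (by positivity))
  choose! z v hb hv hd using hbest
  have hlow : ∀ i ∈ S.erase i₀, -(9 / 4 * ρ ^ 2) ≤ v i := fun i hi => by
    have h1 := (hb i hi).le _ (hmem i i₀ (hlt i hi))
    rw [hrS i₀ hi₀S] at h1
    refine le_trans ?_ h1
    unfold excess
    have h2 : ((1 + η / 2) * ρ) ^ 2 ≤ (3 / 2 * ρ) ^ 2 :=
      pow_le_pow_left₀ (by positivity) (by nlinarith) 2
    have := sq_nonneg (dist (z i) (p i₀))
    simp only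
    nlinarith
  have hstep : ∀ i ∈ S.erase i₀, ∀ j ∈ S.erase i₀, i < j → v i + (η / 2 * ρ) ^ 2 ≤ v j := by
    intro i hi j hj hij
    have h1 := (hb i hi).mono (hb j hj) (hmono i j hij)
    have h2 := h.refutation i
    have h3 := centerRule_sound hη0 (hpos j) (hsome j hj) _ (hmem j i hij)
    rw [hrS i (Finset.mem_of_mem_erase hi)] at h2
    simp only [hrS i (Finset.mem_of_mem_erase hi)] at h3
    have h4 := dist_triangle4 (x i) (z i) (z j) (x j)
    have h5 := dist_triangle (x i) (x j) (p i)
    have h6 := hd i hi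
    have h7 := hd j hj
    rw [dist_comm (z j) (x j), dist_comm (z i) (z j)] at h4
    -- The outputs are more than `η ρ` apart, and each is within `η ρ / 4` of its minimizer.
    have h8 : η / 2 * ρ ≤ dist (z j) (z i) := by
      have : ε = 2 * η := by rw [hη]; ring
      rw [this] at h2
      linarith
    linarith [pow_le_pow_left₀ (by positivity) h8 2]
  obtain ⟨i, hi, hle⟩ := exists_card_mul_le v (S.erase i₀) hlow hstep hne'
  have hc : ((S.erase i₀).card : ℝ) = S.card - 1 := by
    rw [← Finset.card_erase_add_one hi₀S]; push_cast; ring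
  rw [hc] at hle
  have h1 := hle.trans (hv i hi)
  set N : ℝ := (S.card : ℝ)
  have h2 : (N - 2) * (η / 2) ^ 2 ≤ 1024 / η ^ 2 + 9 / 4 := by
    have : (N - 2) * (η / 2) ^ 2 * ρ ^ 2 ≤ (1024 / η ^ 2 + 9 / 4) * ρ ^ 2 := by
      have e : 1024 * ρ ^ 2 / η ^ 2 = 1024 / η ^ 2 * ρ ^ 2 := by ring
      rw [e] at h1
      linarith
    exact le_of_mul_le_mul_right this (by positivity)
  have h3 : N - 2 ≤ (1024 / η ^ 2 + 9 / 4) / (η / 2) ^ 2 := (le_div_iff₀ (by positivity)).2 h2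
  have h4 : (1024 / η ^ 2 + 9 / 4) / (η / 2) ^ 2 = 65536 * (1 / ε) ^ 4 + 36 * (1 / ε) ^ 2 := by
    rw [hη]; field_simp; ring
  have h5 : (1 / ε) ^ 2 ≤ (1 / ε) ^ 4 :=
    pow_le_pow_right₀ ((one_le_div hε).2 hε1.le) (by norm_num)
  linarith

lemma scatterDimOf_centerRule_le {ε : ℝ} (hε : 0 < ε) (hε1 : ε < 1) :
    (scatterDimOf ε centerRule : ℝ≥0∞) ≤
      ENNReal.ofReal (140000 * (1 / ε) ^ 4 * Real.log (2 / ε)) := by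
  have h1 : scatterDimOf ε centerRule ≤ ((⌊70000 * (1 / ε) ^ 4⌋₊ : ℕ) : ℕ∞) := by
    refine sSup_le ?_
    rintro n ⟨d, P, ℓ, x, p, r, ρ, h, rfl⟩
    exact_mod_cast Nat.le_floor (h.card_le hε hε1 ρ)
  have h2 : (scatterDimOf ε centerRule : ℝ≥0∞) ≤ ((⌊70000 * (1 / ε) ^ 4⌋₊ : ℕ) : ℝ≥0∞) := by
    simpa using ENat.toENNReal_le.2 h1
  refine h2.trans ?_
  rw [← ENNReal.ofReal_natCast]
  refine ENNReal.ofReal_le_ofReal ((Nat.floor_le (by positivity)).trans ?_)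
  have h3 : 1 / 2 ≤ Real.log (2 / ε) := by
    have : Real.log 2 ≤ Real.log (2 / ε) :=
      Real.log_le_log two_pos ((le_div_iff₀ hε).2 (by nlinarith))
    linarith [Real.log_two_gt_d9]
  nlinarith [show (0 : ℝ) ≤ (1 / ε) ^ 4 by positivity]

end Scattering

namespace RealRAM

/-! ### Total correctness with step bounds -/

section Hoare

/-- Total correctness: from `s` the program `p` halts within `T` steps in a state satisfying
`post`. -/
def Reaches (p : Prog) (s : State) (T : ℕ) (post : State → Prop) : Prop :=
  ∃ s' t, Runs p s s' t ∧ t ≤ T ∧ post s'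

lemma Reaches.mono {p : Prog} {s : State} {T U : ℕ} {post post' : State → Prop}
    (h : Reaches p s T post) (hT : T ≤ U) (hp : ∀ s', post s' → post' s') :
    Reaches p s U post' := by
  obtain ⟨s', t, hr, ht, hs⟩ := h
  exact ⟨s', t, hr, ht.trans hT, hp s' hs⟩

lemma Reaches.skip {s : State} {T : ℕ} {post : State → Prop} (h : post s) :
    Reaches .skip s T post :=
  ⟨s, 0, .skip s, Nat.zero_le _, h⟩

lemma Reaches.seq {p q : Prog} {s : State} {T U : ℕ} {post : State → Prop}
    (h : Reaches p s T fun s' => Reaches q s' U post) : Reaches (.seq p q) s (T + U) post := by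
  obtain ⟨s', t, hr, ht, s'', u, hr', hu, hp⟩ := h
  exact ⟨s'', t + u, .seq hr hr', Nat.add_le_add ht hu, hp⟩

lemma Reaches.cond {b : Test} {p q : Prog} {s : State} {T : ℕ} {post : State → Prop}
    (hp : b.Holds s → Reaches p s T post) (hq : ¬ b.Holds s → Reaches q s T post) :
    Reaches (.cond b p q) s (T + 1) post := by
  by_cases h : b.Holds s
  · obtain ⟨s', t, hr, ht, hs⟩ := hp h
    exact ⟨s', t + 1, .cond_pos h hr, by omega, hs⟩
  · obtain ⟨s', t, hr, ht, hs⟩ := hq h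
    exact ⟨s', t + 1, .cond_neg h hr, by omega, hs⟩

/-- Straight-line code. -/
def block (l : List Instr) : Prog := l.foldr (fun i p => .seq (.instr i) p) .skip

lemma Reaches.block {l : List Instr} {s : State} {post : State → Prop}
    (h : post (l.foldl (fun s i => i.exec s) s)) : Reaches (block l) s l.length post := by
  induction l generalizing s with
  | nil => exact .skip h
  | cons i l ih =>
    refine Reaches.mono (T := 1 + l.length) (post := post) (.seq ?_)
      (by simp [Nat.add_comm]) fun _ h => h
    exact ⟨_, 1, .instr i s, le_rfl, ih h⟩

/-- A loop with invariant `J` that makes exactly `N` rounds of at most `c` steps. -/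
lemma Reaches.loop {b : Test} {p : Prog} {N c : ℕ} (J : ℕ → State → Prop)
    (hstep : ∀ k < N, ∀ s, J k s → b.Holds s ∧ Reaches p s c (J (k + 1)))
    (hend : ∀ s, J N s → ¬ b.Holds s) {s : State} (h0 : J 0 s) :
    Reaches (.loop b p) s (N * (c + 1) + 1) (J N) := by
  suffices h : ∀ i ≤ N, ∀ s, J (N - i) s → Reaches (.loop b p) s (i * (c + 1) + 1) (J N) from
    h N le_rfl s (by simpa using h0)
  intro i
  induction i with
  | zero =>
    intro _ s hs
    rw [Nat.sub_zero] at hs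
    exact ⟨s, 1, .loop_done (hend s hs), by simp, hs⟩
  | succ i ih =>
    intro hi s hs
    obtain ⟨hb, s', t, hr, ht, hs'⟩ := hstep (N - (i + 1)) (by omega) s hs
    rw [show N - (i + 1) + 1 = N - i by omega] at hs'
    obtain ⟨s'', u, hr', hu, hs''⟩ := ih (by omega) s' hs'
    refine ⟨s'', t + 1 + u, .loop_step hb hr hr', ?_, hs''⟩
    rw [Nat.add_one_mul]
    omega

/-- `s` and `s'` agree except on the cells of `idx` listed in `I` and the registers listed in `R`.
Nothing is said about `mem`. -/
def Frame (I R : List ℕ) (s s' : State) : Prop :=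
  (∀ a, a ∉ I → s'.idx a = s.idx a) ∧ ∀ a, a ∉ R → s'.reg a = s.reg a

lemma Frame.refl (I R : List ℕ) (s : State) : Frame I R s s := ⟨fun _ _ => rfl, fun _ _ => rfl⟩

lemma Frame.trans {I R I' R' I'' R'' : List ℕ} {s s' s'' : State} (h : Frame I R s s')
    (h' : Frame I' R' s' s'') (hI : I ⊆ I'' := by decide) (hR : R ⊆ R'' := by decide)
    (hI' : I' ⊆ I'' := by decide) (hR' : R' ⊆ R'' := by decide) : Frame I'' R'' s s'' :=
  ⟨fun a ha => (h'.1 a fun x => ha (hI' x)).trans (h.1 a fun x => ha (hI x)),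
   fun a ha => (h'.2 a fun x => ha (hR' x)).trans (h.2 a fun x => ha (hR x))⟩

/-- The instruction is not an indirect store into `idx`, and it writes only to cells of `idx` listed
in `I`, to registers listed in `R`, or to `mem`. -/
def Instr.Within (I R : List ℕ) : Instr → Bool
  | .iconst a _ | .iadd a _ _ | .isub a _ _ | .iload a _ => a ∈ I
  | .istore _ _ => false
  | .rconst a _ | .radd a _ _ | .rsub a _ _ | .rmul a _ _ | .rdiv a _ _ | .rload a _ => a ∈ R
  | .rstore _ _ => true

lemma Instr.Within.frame {I R : List ℕ} {i : Instr} (h : i.Within I R = true) (s : State) :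
    Frame I R s (i.exec s) := by
  have key : ∀ {α : Type} {L : List ℕ} {a b : ℕ} {f : ℕ → α} {v : α}, a ∈ L → b ∉ L →
      Function.update f a v b = f b := fun ha hb => Function.update_of_ne (fun e => hb (by rwa [e])) _ _
  cases i <;> simp only [Within, decide_eq_true_eq, Bool.false_eq_true] at h <;>
    exact ⟨fun b hb => by first | rfl | exact key h hb, fun b hb => by first | rfl | exact key h hb⟩

lemma frame_foldl {I R : List ℕ} {l : List Instr} (s : State)
    (h : l.all (Instr.Within I R) = true := by decide) :
    Frame I R s (l.foldl (fun s i => i.exec s) s) := by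
  induction l generalizing s with
  | nil => exact Frame.refl I R s
  | cons i l ih =>
    rw [List.all_cons, Bool.and_eq_true] at h
    exact (Instr.Within.frame h.1 s).trans (ih (i.exec s) h.2) (fun _ h => h) (fun _ h => h)
      (fun _ h => h) fun _ h => h

lemma Frame.foldl {I R : List ℕ} {l : List Instr} {s s' : State} (hF : Frame I R s s')
    (h : l.all (Instr.Within I R) = true := by decide) :
    Frame I R s (l.foldl (fun s i => i.exec s) s') :=
  hF.trans (frame_foldl s' h) (fun _ h => h) (fun _ h => h) (fun _ h => h) fun _ h => h

end Hoare

/-! ### The program -/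

section Program

/-- The squared distance between the current center and the point of the record at address `idx[8]`
goes to `reg[6]`, the radius of that record to `reg[7]`. -/
def distProg : Prog :=
  .seq (block [.iconst 9 0, .iadd 10 8 12, .radd 6 15 15])
  (.seq (.loop (.ilt 9 0) (block [.rload 8 9, .rload 9 10, .rsub 8 8 9, .rmul 8 8 8, .radd 6 6 8,
      .iadd 9 9 3, .iadd 10 10 3]))
    (block [.rload 7 10]))

/-- Runs through all records, and executes `body` on each after `distProg`. -/
def passProg (body : Prog) : Prog :=
  .seq (block [.iadd 8 4 12, .iconst 7 0])
    (.loop (.ilt 7 2) (.seq distProg (.seq body (block [.iadd 8 8 5, .iadd 7 7 3]))))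

/-- The excess of the current record goes to `reg[17]`. -/
def excessInstrs : List Instr := [.rmul 8 2 7, .rmul 8 8 8, .rsub 17 6 8]

/-- Updates the maximum `reg[5]` with the excess of an active record. -/
def maxBody : Prog :=
  .seq (block excessInstrs)
    (.cond (.rlt 4 7) .skip (.cond (.rlt 5 17) (block [.radd 5 17 15]) .skip))

/-- Adds the point of the current record to the accumulator and increments the counter `reg[10]`. -/
def addPoint : Prog :=
  .seq (block [.radd 10 10 1, .iconst 9 0, .iadd 10 8 12, .iadd 13 6 12])
    (.loop (.ilt 9 0) (block [.rload 8 10, .rload 9 13, .radd 8 8 9, .rstore 13 8,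
      .iadd 9 9 3, .iadd 10 10 3, .iadd 13 13 3]))

/-- Calls `addPoint` on an active record whose excess is not below the maximum `reg[5]`. -/
def sumBody : Prog :=
  .seq (block excessInstrs)
    (.cond (.rlt 4 7) .skip (.cond (.rlt 17 5) .skip addPoint))

/-- Replaces the center by the next one and clears the accumulator. -/
def updateProg : Prog :=
  .seq (block [.radd 16 11 1, .iconst 9 0, .iadd 13 6 12])
  (.seq (.loop (.ilt 9 0) (block [.rload 8 9, .rmul 8 8 11, .rload 9 13, .rdiv 9 9 10, .radd 8 8 9,
      .rdiv 8 8 16, .rstore 9 8, .rstore 13 15, .iadd 9 9 3, .iadd 13 13 3]))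
    (block [.radd 11 16 15]))

/-- One round of the iteration. The search for the maximum starts from `-(2 * reg[4]) ^ 2`, which is
a lower bound of every excess of an active constraint. -/
def stepProg : Prog :=
  .seq (block [.radd 8 4 4, .rmul 8 8 8, .rsub 5 15 8])
  (.seq (passProg maxBody)
  (.seq (block [.rconst 10 0])
  (.seq (passProg sumBody) updateProg)))

/-- Clears the flag `idx[11]` if the current record fails the final test. -/
def checkBody : Prog :=
  .seq (block [.rmul 8 13 7])
  (.seq (.cond (.rlt 4 7) (block [.rmul 8 14 7]) .skip)
  (.seq (block [.rmul 8 8 8]) (.cond (.rlt 8 6) (block [.iconst 11 0]) .skip)))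

/-- The iteration and the final test, on an initialized machine. -/
def mainProg : Prog :=
  .seq (block [.rconst 11 0])
  (.seq (.loop (.rlt 11 12) stepProg)
  (.seq (block [.iconst 11 1])
  (.seq (passProg checkBody) (block [.iadd 0 11 12]))))

/-- Lowers `η` to at most `1`, finds the address of the records, sets the center to `0`, finds the
smallest radius and computes the constants.

The center overwrites `mem[0], …, mem[d-1]`: these cells belong to `P`, which is nonempty whenever
there are records to be read. The accumulator lies `d` cells behind the end of the input, so that it
is disjoint from the center even if the input is empty. Throughout, `idx[3] = 1`, `idx[4]` is the
address of the first record, `idx[5]` the length of a record, `idx[6]` the address of the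
accumulator and `idx[12] = 0`; `idx[7]` counts records, `idx[8]` is the address of the current
record, `idx[9]` counts coordinates, `idx[10]` and `idx[13]` are pointers and `idx[11]` is the
result of the test. The registers are `reg[0] = η`, `reg[1] = 1`, `reg[2] = 1 + η / 2`,
`reg[3] = m`, `reg[4]` the cutoff, `reg[11]` and `reg[12]` the number of rounds done and its bound,
`reg[13] = 1 + η`, `reg[14] = 1 + η / 4` and `reg[15] = 0`. -/
def initProg : Prog :=
  .seq (block [.iconst 3 1, .iadd 5 0 3, .rconst 1 1])
  (.seq (.cond (.rlt 1 0) (block [.rconst 0 1]) .skip)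
  (.seq (.loop (.ilt 7 1) (block [.iadd 4 4 0, .iadd 7 7 3]))
  (.seq (.loop (.ilt 9 0) (block [.rstore 9 15, .iadd 9 9 3]))
  (.seq (block [.iadd 8 4 12, .iadd 10 8 0, .rload 3 10, .iconst 7 0])
  (.seq (.loop (.ilt 7 2) (.seq (block [.iadd 10 8 0, .rload 7 10])
    (.seq (.cond (.rlt 7 3) (block [.radd 3 7 15]) .skip) (block [.iadd 8 8 5, .iadd 7 7 3]))))
    (block [.iadd 6 8 0, .rconst 8 16, .rmul 8 8 3, .rdiv 4 8 0, .rconst 8 2, .rdiv 8 0 8,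
      .radd 2 1 8, .radd 13 1 0, .rconst 8 4, .rdiv 8 0 8, .radd 14 1 8, .rmul 8 0 0, .rmul 8 8 8,
      .rconst 9 65536, .rdiv 12 9 8]))))))

/-- The program computing `centerRule`. -/
def ballProg : Prog := .seq initProg mainProg

end Program

/-! ### Correctness of the main part -/

section Correctness

variable {d n base : ℕ} {q : ℕ → Euc d × ℝ} {η M : ℝ}

/-- The part of the state that stays fixed during the main part: the constants, and `n` intact
records `q 0, …, q (n - 1)` from address `base` on. -/
structure Env (n base : ℕ) (q : ℕ → Euc d × ℝ) (η M : ℝ) (s : State) : Prop where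
  i0 : s.idx 0 = d
  i2 : s.idx 2 = n
  i3 : s.idx 3 = 1
  i4 : s.idx 4 = base
  i5 : s.idx 5 = d + 1
  i6 : s.idx 6 = base + n * (d + 1) + d
  i12 : s.idx 12 = 0
  r1 : s.reg 1 = 1
  r2 : s.reg 2 = 1 + η / 2
  r4 : s.reg 4 = M
  r12 : s.reg 12 = 65536 / η ^ 4
  r13 : s.reg 13 = 1 + η
  r14 : s.reg 14 = 1 + η / 4
  r15 : s.reg 15 = 0
  point : ∀ i < n, ∀ j : Fin d, s.mem (base + i * (d + 1) + j) = (q i).1 j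
  radius : ∀ i < n, s.mem (base + i * (d + 1) + d) = (q i).2

lemma Env.of_frame {s s' : State} (h : Env n base q η M s)
    (hF : Frame [7, 8, 9, 10, 11, 13] [3, 5, 6, 7, 8, 9, 10, 11, 16, 17] s s')
    (hm : ∀ a, base ≤ a → a < base + n * (d + 1) → s'.mem a = s.mem a) :
    Env n base q η M s' := by
  have hlt : ∀ i < n, ∀ j ≤ d, base + i * (d + 1) + j < base + n * (d + 1) := fun i hi j hj => by
    have : (i + 1) * (d + 1) ≤ n * (d + 1) := Nat.mul_le_mul_right _ hi
    rw [Nat.add_one_mul] at this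
    omega
  refine ⟨?_, ?_, ?_, ?_, ?_, ?_, ?_, ?_, ?_, ?_, ?_, ?_, ?_, ?_, fun i hi j => ?_, fun i hi => ?_⟩
  · rw [hF.1 _ (by decide), h.i0]
  · rw [hF.1 _ (by decide), h.i2]
  · rw [hF.1 _ (by decide), h.i3]
  · rw [hF.1 _ (by decide), h.i4]
  · rw [hF.1 _ (by decide), h.i5]
  · rw [hF.1 _ (by decide), h.i6]
  · rw [hF.1 _ (by decide), h.i12]
  · rw [hF.2 _ (by decide), h.r1]
  · rw [hF.2 _ (by decide), h.r2]
  · rw [hF.2 _ (by decide), h.r4]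
  · rw [hF.2 _ (by decide), h.r12]
  · rw [hF.2 _ (by decide), h.r13]
  · rw [hF.2 _ (by decide), h.r14]
  · rw [hF.2 _ (by decide), h.r15]
  · rw [hm _ (by omega) (hlt i hi j j.2.le), h.point i hi j]
  · rw [hm _ (by omega) (hlt i hi d le_rfl), h.radius i hi]

lemma Env.of_frame_of_mem_eq {s s' : State} {I R : List ℕ} (h : Env n base q η M s)
    (hF : Frame I R s s') (hm : s'.mem = s.mem)
    (hI : I ⊆ [7, 8, 9, 10, 11, 13] := by decide)
    (hR : R ⊆ [3, 5, 6, 7, 8, 9, 10, 11, 16, 17] := by decide) : Env n base q η M s' :=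
  h.of_frame ((Frame.refl [] [] s).trans hF (by simp) (by simp) hI hR) fun _ _ _ => by rw [hm]

/-- The coordinates of `y` are stored from address `a` on. -/
def HoldsAt (a : ℕ) (y : Euc d) (s : State) : Prop := ∀ j : Fin d, s.mem (a + j) = y j

lemma reaches_distProg {s : State} {x : Euc d} {k : ℕ} (h : Env n base q η M s)
    (hx : HoldsAt 0 x s) (hk : k < n) (h8 : s.idx 8 = base + k * (d + 1)) :
    Reaches distProg s (8 * d + 5) fun s' => Frame [9, 10] [6, 7, 8, 9] s s' ∧ s'.mem = s.mem ∧
      s'.reg 6 = dist x (q k).1 ^ 2 ∧ s'.reg 7 = (q k).2 := by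
  rw [show 8 * d + 5 = 3 + (d * (7 + 1) + 1 + 1) by ring]
  refine .seq (.block ?_)
  refine .seq ?_
  refine Reaches.mono (Reaches.loop (fun k s' => Frame [9, 10] [6, 7, 8, 9] s s' ∧
    s'.mem = s.mem ∧ s'.idx 9 = k ∧ s'.idx 10 = s.idx 8 + k ∧
    s'.reg 6 = ∑ j ∈ Finset.range k, (s.mem j - s.mem (s.idx 8 + j)) ^ 2) ?_ ?_ ?_) le_rfl ?_
  · rintro k hk s' ⟨hF, hm, h9, h10, h6⟩
    have h0 : s'.idx 0 = d := (hF.1 0 (by decide)).trans h.i0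
    have h3 : s'.idx 3 = 1 := (hF.1 3 (by decide)).trans h.i3
    refine ⟨by simp only [Test.Holds]; omega, .block ⟨hF.foldl, ?_, ?_, ?_, ?_⟩⟩
    · simpa [Instr.exec] using hm
    · simp [Instr.exec, h9, h3]
    · simp [Instr.exec, h10, h3, Nat.add_assoc]
    · simp [Instr.exec, h6, h9, h10, hm, Finset.sum_range_succ, sq]
  · rintro s' ⟨hF, hm, h9, h10, h6⟩
    have h0 : s'.idx 0 = d := (hF.1 0 (by decide)).trans h.i0
    simp only [Test.Holds]; omega
  · refine ⟨frame_foldl s, ?_, ?_, ?_, ?_⟩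
    · simp [Instr.exec]
    · simp [Instr.exec]
    · simp [Instr.exec, h.i12]
    · simp [Instr.exec, h.r15]
  · rintro s' ⟨hF, hm, h9, h10, h6⟩
    refine .block ⟨hF.foldl, ?_, ?_, ?_⟩
    · simpa [Instr.exec] using hm
    · simp only [List.foldl, Instr.exec]
      rw [Function.update_of_ne (by decide), h6, EuclideanSpace.dist_sq_eq, Finset.sum_range]
      refine Finset.sum_congr rfl fun j _ => ?_
      have := hx j
      rw [Nat.zero_add] at this
      rw [Real.dist_eq, sq_abs, this, h8, h.point k hk j]
    · simp [Instr.exec, h10, hm, h8, h.radius k hk]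

/-- Rule for passes: an invariant `J` that does not depend on the cells used by the traversal is
preserved if `body` takes `J k` to `J (k + 1)` on the `k`-th record. -/
lemma reaches_passProg {s : State} {x : Euc d} {body : Prog} {c : ℕ} (J : ℕ → State → Prop)
    (h : Env n base q η M s) (hx : HoldsAt 0 x s) (h0 : J 0 s)
    (hJ : ∀ k s s', J k s → Frame [7, 8, 9, 10] [6, 7, 8, 9] s s' → s'.mem = s.mem → J k s')
    (hbody : ∀ k < n, ∀ s, J k s → Env n base q η M s → HoldsAt 0 x s →
      s.idx 8 = base + k * (d + 1) → s.reg 6 = dist x (q k).1 ^ 2 → s.reg 7 = (q k).2 →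
      Reaches body s c fun s' => J (k + 1) s' ∧ Env n base q η M s' ∧ HoldsAt 0 x s' ∧
        s'.idx 7 = s.idx 7 ∧ s'.idx 8 = s.idx 8) :
    Reaches (passProg body) s (n * (8 * d + c + 8) + 3) fun s' =>
      J n s' ∧ Env n base q η M s' ∧ HoldsAt 0 x s' := by
  rw [show n * (8 * d + c + 8) + 3 = 2 + (n * (8 * d + 5 + (c + 2) + 1) + 1) by ring]
  refine .seq (.block ?_)
  refine Reaches.mono (Reaches.loop (fun k s' => J k s' ∧ Env n base q η M s' ∧ HoldsAt 0 x s' ∧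
    s'.idx 7 = k ∧ s'.idx 8 = base + k * (d + 1)) ?_ ?_ ?_) le_rfl ?_
  · rintro k hk s' ⟨hj, hE, hX, h7, h8⟩
    refine ⟨by simp only [Test.Holds]; rw [hE.i2]; omega, .seq ?_⟩
    refine (reaches_distProg hE hX hk h8).mono le_rfl ?_
    rintro s₁ ⟨hF, hm, h6, hr7⟩
    have hE₁ := hE.of_frame_of_mem_eq hF hm
    have hX₁ : HoldsAt 0 x s₁ := fun j => by rw [hm]; exact hX j
    have hJ₁ := hJ k s' s₁ hj ((Frame.refl [] [] s').trans hF) hm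
    refine .seq ?_
    refine (hbody k hk s₁ hJ₁ hE₁ hX₁ ((hF.1 8 (by decide)).trans h8) h6 hr7).mono le_rfl ?_
    rintro s₂ ⟨hJ₂, hE₂, hX₂, h72, h82⟩
    have hF₃ := frame_foldl (I := [7, 8, 9, 10]) (R := [6, 7, 8, 9])
      (l := [.iadd 8 8 5, .iadd 7 7 3]) s₂
    refine .block ⟨hJ _ _ _ hJ₂ hF₃ rfl, hE₂.of_frame_of_mem_eq hF₃ rfl, hX₂, ?_, ?_⟩
    · simp [Instr.exec, h72, hE₂.i3, hF.1 7 (by decide), h7]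
    · simp [Instr.exec, h82, hE₂.i5, hF.1 8 (by decide), h8]
      ring
  · rintro s' ⟨hj, hE, hX, h7, h8⟩
    simp only [Test.Holds]; rw [hE.i2]; omega
  · have hF₃ := frame_foldl (I := [7, 8, 9, 10]) (R := [6, 7, 8, 9])
      (l := [.iadd 8 4 12, .iconst 7 0]) s
    refine ⟨hJ _ _ _ h0 hF₃ rfl, h.of_frame_of_mem_eq hF₃ rfl, hx, ?_, ?_⟩
    · simp [Instr.exec]
    · simp [Instr.exec, h.i4, h.i12]
  · rintro s' ⟨hj, hE, hX, -⟩
    exact ⟨hj, hE, hX⟩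

lemma reaches_excess {s : State} {x : Euc d} {k : ℕ} (h : Env n base q η M s)
    (h6 : s.reg 6 = dist x (q k).1 ^ 2) (h7 : s.reg 7 = (q k).2) :
    Reaches (block excessInstrs) s 3 fun s' => Frame [] [8, 17] s s' ∧ s'.mem = s.mem ∧
      s'.reg 17 = excess (1 + η / 2) (q k) x :=
  .block ⟨frame_foldl s, rfl, by simp [excessInstrs, Instr.exec, h6, h7, h.r2, excess, sq]⟩

lemma reaches_maxPass {s : State} {x : Euc d} (h : Env n base q η M s) (hx : HoldsAt 0 x s) :
    Reaches (passProg maxBody) s (n * (8 * d + 14) + 3) fun s' =>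
      Frame [7, 8, 9, 10] [5, 6, 7, 8, 9, 17] s s' ∧ s'.mem = s.mem ∧
      (∀ i < n, (q i).2 ≤ M → excess (1 + η / 2) (q i) x ≤ s'.reg 5) ∧
      (s'.reg 5 = s.reg 5 ∨ ∃ i < n, (q i).2 ≤ M ∧ s'.reg 5 = excess (1 + η / 2) (q i) x) ∧
      Env n base q η M s' ∧ HoldsAt 0 x s' := by
  refine (reaches_passProg (c := 6) (fun k s' =>
    Frame [7, 8, 9, 10] [5, 6, 7, 8, 9, 17] s s' ∧ s'.mem = s.mem ∧
    (∀ i < k, (q i).2 ≤ M → excess (1 + η / 2) (q i) x ≤ s'.reg 5) ∧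
    (s'.reg 5 = s.reg 5 ∨ ∃ i < k, (q i).2 ≤ M ∧ s'.reg 5 = excess (1 + η / 2) (q i) x))
    h hx ?_ ?_ ?_).mono le_rfl fun s' ⟨⟨a, b, c, e⟩, f, g⟩ => ⟨a, b, c, e, f, g⟩
  · exact ⟨Frame.refl _ _ s, rfl, by simp, .inl rfl⟩
  · rintro k s₁ s₂ ⟨hF, hm, hle, hv⟩ hF' hm'
    rw [hF'.2 5 (by decide)]
    exact ⟨hF.trans hF', hm'.trans hm, hle, hv⟩
  · rintro k hk s₁ ⟨hF, hm, hle, hv⟩ hE hX h8 h6 h7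
    rw [show 6 = 3 + (1 + 1 + 1) by rfl]
    refine .seq ((reaches_excess hE h6 h7).mono le_rfl ?_)
    rintro s₂ ⟨hF₂, hm₂, h17⟩
    have h5 := hF₂.2 5 (by decide)
    have hF' := hF.trans hF₂ (I'' := [7, 8, 9, 10]) (R'' := [5, 6, 7, 8, 9, 17])
    have hE₂ := hE.of_frame_of_mem_eq hF₂ hm₂
    have hX₂ : HoldsAt 0 x s₂ := fun j => by rw [hm₂]; exact hX j
    have hi7 := hF₂.1 7 (by decide)
    have hi8 := hF₂.1 8 (by decide)
    refine .cond (fun hb => .skip ?_) fun hb => .cond (fun hb' => ?_) fun hb' => .skip ?_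
    · rw [Test.Holds, hE₂.r4, hF₂.2 7 (by decide), h7] at hb
      refine ⟨⟨hF', hm₂.trans hm, fun i hi hr => ?_, ?_⟩, hE₂, hX₂, hi7, hi8⟩
      · rcases Nat.lt_succ_iff_lt_or_eq.1 hi with hi | rfl
        · rw [h5]; exact hle i hi hr
        · exact absurd hb (not_lt.2 hr)
      · rw [h5]
        exact hv.imp_right fun ⟨i, hi, hr⟩ => ⟨i, by omega, hr⟩
    · rw [Test.Holds, hE₂.r4, hF₂.2 7 (by decide), h7] at hb
      rw [Test.Holds, h17, h5] at hb'
      have hF₃ := frame_foldl (I := []) (R := [5]) (l := [.radd 5 17 15]) s₂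
      have h53 : ([Instr.radd 5 17 15].foldl (fun s i => i.exec s) s₂).reg 5 =
          excess (1 + η / 2) (q k) x := by
        simp [Instr.exec, hE₂.r15, h17]
      refine .block ⟨⟨hF'.trans hF₃, hm₂.trans hm, fun i hi hr => ?_, ?_⟩,
        hE₂.of_frame_of_mem_eq hF₃ rfl, hX₂, hi7, hi8⟩
      · rw [h53]
        rcases Nat.lt_succ_iff_lt_or_eq.1 hi with hi | rfl
        · exact (hle i hi hr).trans hb'.le
        · exact le_rfl
      · exact .inr ⟨k, by omega, not_lt.1 hb, h53⟩
    · rw [Test.Holds, h17, h5] at hb'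
      refine ⟨⟨hF', hm₂.trans hm, fun i hi hr => ?_, ?_⟩, hE₂, hX₂, hi7, hi8⟩
      · rw [h5]
        rcases Nat.lt_succ_iff_lt_or_eq.1 hi with hi | rfl
        · exact hle i hi hr
        · exact not_lt.1 hb'
      · rw [h5]
        exact hv.imp_right fun ⟨i, hi, hr⟩ => ⟨i, by omega, hr⟩

lemma reaches_addPoint {s : State} {y : Euc d} {k : ℕ} (h : Env n base q η M s)
    (hy : HoldsAt (base + n * (d + 1) + d) y s) (hk : k < n)
    (h8 : s.idx 8 = base + k * (d + 1)) :
    Reaches addPoint s (8 * d + 5) fun s' => Frame [9, 10, 13] [8, 9, 10] s s' ∧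
      s'.reg 10 = s.reg 10 + 1 ∧ HoldsAt (base + n * (d + 1) + d) (y + (q k).1) s' ∧
      ∀ a < base + n * (d + 1) + d, s'.mem a = s.mem a := by
  set acc := base + n * (d + 1) + d with hacc
  have hle : (k + 1) * (d + 1) ≤ n * (d + 1) := Nat.mul_le_mul_right _ hk
  rw [Nat.add_one_mul] at hle
  rw [show 8 * d + 5 = 4 + (d * (7 + 1) + 1) by ring]
  refine .seq (.block ?_)
  refine Reaches.mono (Reaches.loop (fun l s' => Frame [9, 10, 13] [8, 9, 10] s s' ∧
    s'.reg 10 = s.reg 10 + 1 ∧ s'.idx 9 = l ∧ s'.idx 10 = s.idx 8 + l ∧ s'.idx 13 = acc + l ∧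
    (∀ j < l, s'.mem (acc + j) = s.mem (acc + j) + s.mem (s.idx 8 + j)) ∧
    (∀ j, l ≤ j → s'.mem (acc + j) = s.mem (acc + j)) ∧ ∀ a < acc, s'.mem a = s.mem a)
    ?_ ?_ ?_) le_rfl ?_
  · rintro l hl s' ⟨hF, hc, h9, h10, h13, hlt, hge, hlow⟩
    have h0 : s'.idx 0 = d := (hF.1 0 (by decide)).trans h.i0
    have h3 : s'.idx 3 = 1 := (hF.1 3 (by decide)).trans h.i3
    refine ⟨by simp only [Test.Holds]; omega,
      .block ⟨hF.foldl, ?_, ?_, ?_, ?_, ?_, ?_, ?_⟩⟩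
    · simpa [Instr.exec] using hc
    · simp [Instr.exec, h9, h3]
    · simp [Instr.exec, h10, h3, Nat.add_assoc]
    · simp [Instr.exec, h13, h3, Nat.add_assoc]
    · intro j hj
      rcases Nat.lt_succ_iff_lt_or_eq.1 hj with hj | rfl
      · simp [Instr.exec, h13, hlt j hj, hj.ne]
      · have h1 := hge j le_rfl
        have h2 := hlow (s.idx 8 + j) (by omega)
        simp [Instr.exec, h13, h10, h1, h2, add_comm (s.mem (s.idx 8 + j))]
    · intro j hj
      simp [Instr.exec, h13, hge j (by omega), show j ≠ l by omega]
    · intro a ha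
      simp [Instr.exec, h13, hlow a ha, show a ≠ acc + l by omega]
  · rintro s' ⟨hF, -, h9, -⟩
    have h0 : s'.idx 0 = d := (hF.1 0 (by decide)).trans h.i0
    simp only [Test.Holds]; omega
  · refine ⟨frame_foldl s, ?_, ?_, ?_, ?_, ?_, ?_, ?_⟩ <;>
      simp [Instr.exec, h.r1, h.i12, h.i6, hacc]
  · rintro s' ⟨hF, hc, h9, h10, h13, hlt, hge, hlow⟩
    refine ⟨hF, hc, fun j => ?_, hlow⟩
    rw [hlt j j.2, hy j, h8, h.point k hk j]
    rfl

lemma HoldsAt.congr {a : ℕ} {y : Euc d} {s s' : State} (h : HoldsAt a y s)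
    (hm : ∀ j < d, s'.mem (a + j) = s.mem (a + j)) : HoldsAt a y s' :=
  fun j => (hm j j.2).trans (h j)

open Classical in
lemma reaches_sumPass {s : State} {x : Euc d} (h : Env n base q η M s) (hx : HoldsAt 0 x s)
    (h0 : HoldsAt (base + n * (d + 1) + d) (0 : Euc d) s) (hc : s.reg 10 = 0) :
    Reaches (passProg sumBody) s (n * (16 * d + 18) + 3) fun s' =>
      s'.reg 11 = s.reg 11 ∧
      s'.reg 10 = (((Finset.range n).filter fun i =>
        (q i).2 ≤ M ∧ s.reg 5 ≤ excess (1 + η / 2) (q i) x).card : ℝ) ∧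
      HoldsAt (base + n * (d + 1) + d) (∑ i ∈ (Finset.range n).filter fun i =>
        (q i).2 ≤ M ∧ s.reg 5 ≤ excess (1 + η / 2) (q i) x, (q i).1) s' ∧
      Env n base q η M s' ∧ HoldsAt 0 x s' := by
  set acc := base + n * (d + 1) + d with hacc
  set G : ℕ → Finset ℕ := fun k => (Finset.range k).filter fun i =>
    (q i).2 ≤ M ∧ s.reg 5 ≤ excess (1 + η / 2) (q i) x with hG
  have hGs : ∀ k, ((q k).2 ≤ M ∧ s.reg 5 ≤ excess (1 + η / 2) (q k) x) →
      G (k + 1) = insert k (G k) := fun k hk => by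
    simp only [hG]
    rw [Finset.range_add_one, Finset.filter_insert, if_pos hk]
  have hGn : ∀ k, ¬ ((q k).2 ≤ M ∧ s.reg 5 ≤ excess (1 + η / 2) (q k) x) →
      G (k + 1) = G k := fun k hk => by
    simp only [hG]
    rw [Finset.range_add_one, Finset.filter_insert, if_neg hk]
  have hGk : ∀ k, k ∉ G k := fun k => by simp [hG]
  rw [show n * (16 * d + 18) + 3 = n * (8 * d + (3 + (8 * d + 5 + 1 + 1)) + 8) + 3 by ring]
  refine (reaches_passProg (fun k s' =>
    Frame [7, 8, 9, 10, 13] [6, 7, 8, 9, 10, 17] s s' ∧ s'.reg 10 = ((G k).card : ℝ) ∧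
    HoldsAt acc (∑ i ∈ G k, (q i).1) s')
    h hx ?_ ?_ ?_).mono le_rfl fun s' ⟨⟨a, b, c⟩, e, f⟩ => ⟨a.2 11 (by decide), b, c, e, f⟩
  · exact ⟨Frame.refl _ _ s, by simp [hG, hc], by simpa [hG] using h0⟩
  · rintro k s₁ s₂ ⟨hF, hc, hy⟩ hF' hm'
    exact ⟨hF.trans hF', by rw [hF'.2 10 (by decide), hc], hy.congr fun _ _ => by rw [hm']⟩
  · rintro k hk s₁ ⟨hF, hc₁, hy⟩ hE hX h8 h6 h7
    refine .seq ((reaches_excess hE h6 h7).mono le_rfl ?_)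
    rintro s₂ ⟨hF₂, hm₂, h17⟩
    have h5 : s₂.reg 5 = s.reg 5 := (hF₂.2 5 (by decide)).trans (hF.2 5 (by decide))
    have hF' := hF.trans hF₂ (I'' := [7, 8, 9, 10, 13]) (R'' := [6, 7, 8, 9, 10, 17])
    have hE₂ := hE.of_frame_of_mem_eq hF₂ hm₂
    have hX₂ : HoldsAt 0 x s₂ := hX.congr fun _ _ => by rw [hm₂]
    have hy₂ : HoldsAt acc (∑ i ∈ G k, (q i).1) s₂ := hy.congr fun _ _ => by rw [hm₂]
    have hc₂ : s₂.reg 10 = ((G k).card : ℝ) := (hF₂.2 10 (by decide)).trans hc₁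
    have hi7 := hF₂.1 7 (by decide)
    have hi8 := hF₂.1 8 (by decide)
    refine .cond (fun hb => .skip ?_) fun hb => .cond (fun hb' => .skip ?_) fun hb' => ?_
    · rw [Test.Holds, hE₂.r4, hF₂.2 7 (by decide), h7] at hb
      rw [hGn k fun h => absurd hb (not_lt.2 h.1)]
      exact ⟨⟨hF', hc₂, hy₂⟩, hE₂, hX₂, hi7, hi8⟩
    · rw [Test.Holds, h17, h5] at hb'
      rw [hGn k fun h => absurd hb' (not_lt.2 h.2)]
      exact ⟨⟨hF', hc₂, hy₂⟩, hE₂, hX₂, hi7, hi8⟩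
    · rw [Test.Holds, hE₂.r4, hF₂.2 7 (by decide), h7, not_lt] at hb
      rw [Test.Holds, h17, h5, not_lt] at hb'
      refine (reaches_addPoint hE₂ hy₂ hk (hi8.trans h8)).mono le_rfl ?_
      rintro s₃ ⟨hF₃, hc₃, hy₃, hm₃⟩
      rw [hGs k ⟨hb, hb'⟩, Finset.card_insert_of_notMem (hGk k),
        Finset.sum_insert (hGk k), add_comm (q k).1]
      refine ⟨⟨hF'.trans hF₃, by rw [hc₃, hc₂]; push_cast; rfl, hy₃⟩,
        hE₂.of_frame ((Frame.refl [] [] s₂).trans hF₃) fun a _ ha => hm₃ a (by omega),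
        hX₂.congr fun j hj => hm₃ _ (by omega), (hF₃.1 7 (by decide)).trans hi7,
        (hF₃.1 8 (by decide)).trans hi8⟩

lemma reaches_updateProg {s : State} {x y : Euc d} (hsep : n = 0 ∨ d ≤ base)
    (h : Env n base q η M s) (hx : HoldsAt 0 x s) (hy : HoldsAt (base + n * (d + 1) + d) y s) :
    Reaches updateProg s (11 * d + 5) fun s' =>
      s'.reg 11 = s.reg 11 + 1 ∧ HoldsAt (base + n * (d + 1) + d) (0 : Euc d) s' ∧
      Env n base q η M s' ∧
      HoldsAt 0 ((s.reg 11 + 1)⁻¹ • (s.reg 11 • x + (s.reg 10)⁻¹ • y)) s' := by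
  set acc := base + n * (d + 1) + d with hacc
  have hrec : ∀ a, base ≤ a → a < base + n * (d + 1) → d ≤ a := fun a ha ha' => by
    rcases hsep with rfl | h <;> omega
  rw [show 11 * d + 5 = 3 + (d * (10 + 1) + 1 + 1) by ring]
  refine .seq (.block (.seq ?_))
  refine Reaches.mono (Reaches.loop (fun l s' => Frame [9, 13] [8, 9, 16] s s' ∧
    s'.reg 16 = s.reg 11 + 1 ∧ s'.idx 9 = l ∧ s'.idx 13 = acc + l ∧
    (∀ j < l, s'.mem j = (s.mem j * s.reg 11 + s.mem (acc + j) / s.reg 10) / (s.reg 11 + 1)) ∧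
    (∀ j < l, s'.mem (acc + j) = 0) ∧
    ∀ a, l ≤ a → (a < acc ∨ acc + l ≤ a) → s'.mem a = s.mem a)
    ?_ ?_ ?_) le_rfl ?_
  · rintro l hl s' ⟨hF, h16, h9, h13, hlt, hz, hm⟩
    have h0 : s'.idx 0 = d := (hF.1 0 (by decide)).trans h.i0
    have h3 : s'.idx 3 = 1 := (hF.1 3 (by decide)).trans h.i3
    have h15 : s'.reg 15 = 0 := (hF.2 15 (by decide)).trans h.r15
    have h10 : s'.reg 10 = s.reg 10 := hF.2 10 (by decide)
    have h11 : s'.reg 11 = s.reg 11 := hF.2 11 (by decide)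
    refine ⟨by simp only [Test.Holds]; omega,
      .block ⟨hF.foldl, ?_, ?_, ?_, ?_, ?_, ?_⟩⟩
    · simpa [Instr.exec] using h16
    · simp [Instr.exec, h9, h3]
    · simp [Instr.exec, h13, h3, Nat.add_assoc]
    · intro j hj
      have hne : j ≠ acc + l := by omega
      rcases Nat.lt_succ_iff_lt_or_eq.1 hj with hj | rfl
      · simp [Instr.exec, h13, h9, hlt j hj, hj.ne, hne]
      · have h1 := hm j le_rfl (.inl (by omega))
        have h2 := hm (acc + j) (by omega) (.inr le_rfl)
        simp only [List.foldl, Instr.exec]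
        simp [h13, h9, h1, h2, h10, h11, h16]
        rw [Function.update_of_ne hne, Function.update_self]
    · intro j hj
      have hne : acc + j ≠ l := by omega
      rcases Nat.lt_succ_iff_lt_or_eq.1 hj with hj | rfl
      · simp [Instr.exec, h13, h9, hz j hj, hj.ne, hne]
      · simp [Instr.exec, h13, h15]
    · intro a ha ha'
      have h1 := hm a (by omega) (by omega)
      simp [Instr.exec, h13, h9, h1, show a ≠ l by omega, show a ≠ acc + l by omega]
  · rintro s' ⟨hF, -, h9, -⟩
    have h0 : s'.idx 0 = d := (hF.1 0 (by decide)).trans h.i0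
    simp only [Test.Holds]; omega
  · refine ⟨frame_foldl s, ?_, ?_, ?_, ?_, ?_, ?_⟩ <;>
      simp [Instr.exec, h.r1, h.i12, h.i6, hacc]
  · rintro s' ⟨hF, h16, h9, h13, hlt, hz, hm⟩
    have hE : Env n base q η M s' := h.of_frame ((Frame.refl [] [] s).trans hF)
      fun a ha ha' => hm a (hrec a ha ha') (.inl (by omega))
    have hF' := frame_foldl (I := []) (R := [11]) (l := [.radd 11 16 15]) s'
    refine .block ⟨?_, fun j => hz j j.2, hE.of_frame_of_mem_eq hF' rfl, fun j => ?_⟩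
    · simp [Instr.exec, h16, hE.r15]
    · have h1 := hx j
      have h2 := hlt j j.2
      rw [Nat.zero_add] at h1 ⊢
      rw [hy j, h1] at h2
      change s'.mem j = _
      rw [h2]
      simp only [PiLp.smul_apply, PiLp.add_apply, smul_eq_mul]
      rw [div_eq_inv_mul, div_eq_inv_mul (y j), mul_comm (x j)]

/-- The two passes of a round compute the target. If the maximum `v` still has its initial value,
then all active constraints have this excess. -/
lemma target_active_eq {Q : Finset (Euc d × ℝ)} (hη : 0 < η) (hη1 : η ≤ 1)
    (hr : ∀ p ∈ Q, 0 < p.2)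
    (hinj : Set.InjOn q (Finset.range n)) (hQ : ∀ p, p ∈ Q ↔ ∃ i < n, q i = p) {x : Euc d} {v : ℝ}
    (hle : ∀ i < n, (q i).2 ≤ cutoff η Q → excess (1 + η / 2) (q i) x ≤ v)
    (hv : v = -(2 * cutoff η Q) ^ 2 ∨
      ∃ i < n, (q i).2 ≤ cutoff η Q ∧ v = excess (1 + η / 2) (q i) x) :
    target (1 + η / 2) (active η Q) x =
      (((Finset.range n).filter fun i =>
        (q i).2 ≤ cutoff η Q ∧ v ≤ excess (1 + η / 2) (q i) x).card : ℝ)⁻¹ •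
      ∑ i ∈ (Finset.range n).filter fun i =>
        (q i).2 ≤ cutoff η Q ∧ v ≤ excess (1 + η / 2) (q i) x, (q i).1 := by
  classical
  have hF : farthest (1 + η / 2) (active η Q) x = ((Finset.range n).filter fun i =>
      (q i).2 ≤ cutoff η Q ∧ v ≤ excess (1 + η / 2) (q i) x).image q := by
    ext p
    simp only [farthest, active, Finset.mem_filter, Finset.mem_image, Finset.mem_range]
    constructor
    · rintro ⟨⟨hp, hpM⟩, hmax⟩
      obtain ⟨i, hi, rfl⟩ := (hQ p).1 hp
      refine ⟨i, ⟨hi, hpM, ?_⟩, rfl⟩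
      rcases hv with hv | ⟨j, hj, hjM, hv⟩
      · have h1 := hr _ hp
        have h2 : ((1 + η / 2) * (q i).2) ^ 2 ≤ (2 * cutoff η Q) ^ 2 :=
          pow_le_pow_left₀ (by positivity) (mul_le_mul (by linarith) hpM h1.le (by norm_num)) 2
        rw [hv, excess]
        linarith [sq_nonneg (dist x (q i).1)]
      · rw [hv]
        exact hmax _ ⟨(hQ _).2 ⟨j, hj, rfl⟩, hjM⟩
    · rintro ⟨i, ⟨hi, hiM, hvi⟩, rfl⟩
      refine ⟨⟨(hQ _).2 ⟨i, hi, rfl⟩, hiM⟩, fun p hp => ?_⟩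
      obtain ⟨j, hj, rfl⟩ := (hQ p).1 hp.1
      exact (hle j hj hp.2).trans hvi
  have hinj' := hinj.mono (s₁ := ((Finset.range n).filter fun i =>
    (q i).2 ≤ cutoff η Q ∧ v ≤ excess (1 + η / 2) (q i) x)) (by
      intro i hi
      exact Finset.mem_coe.2 (Finset.mem_filter.1 hi).1)
  rw [target, hF, Finset.card_image_of_injOn hinj', Finset.sum_image hinj']

lemma reaches_stepProg {Q : Finset (Euc d × ℝ)} (hη : 0 < η) (hη1 : η ≤ 1)
    (hr : ∀ p ∈ Q, 0 < p.2)
    (hinj : Set.InjOn q (Finset.range n)) (hQ : ∀ p, p ∈ Q ↔ ∃ i < n, q i = p)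
    (hsep : n = 0 ∨ d ≤ base) {s : State} {t : ℕ} (h : Env n base q η (cutoff η Q) s)
    (hx : HoldsAt 0 (centerSeq (1 + η / 2) (active η Q) t : Euc d) s)
    (hy : HoldsAt (base + n * (d + 1) + d) (0 : Euc d) s) (ht : s.reg 11 = t) :
    Reaches stepProg s (n * (24 * d + 32) + 11 * d + 15) fun s' =>
      Env n base q η (cutoff η Q) s' ∧
      HoldsAt 0 (centerSeq (1 + η / 2) (active η Q) (t + 1) : Euc d) s' ∧
      HoldsAt (base + n * (d + 1) + d) (0 : Euc d) s' ∧ s'.reg 11 = (t + 1 : ℕ) := by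
  classical
  rw [show n * (24 * d + 32) + 11 * d + 15 = 3 + (n * (8 * d + 14) + 3 +
    (1 + (n * (16 * d + 18) + 3 + (11 * d + 5)))) by ring]
  have hF := frame_foldl (I := []) (R := [5, 8])
    (l := [.radd 8 4 4, .rmul 8 8 8, .rsub 5 15 8]) s
  refine .seq (.block (.seq ?_))
  refine (reaches_maxPass (h.of_frame_of_mem_eq hF rfl) hx).mono le_rfl ?_
  rintro s₁ ⟨hF₁, hm₁, hle, hv, hE₁, hX₁⟩
  have hv' : s₁.reg 5 = -(2 * cutoff η Q) ^ 2 ∨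
      ∃ i < n, (q i).2 ≤ cutoff η Q ∧
        s₁.reg 5 = excess (1 + η / 2) (q i) (centerSeq (1 + η / 2) (active η Q) t) := by
    refine hv.imp_left fun e => ?_
    rw [e]
    simp [Instr.exec, h.r4, h.r15]
    ring
  have hF₂ := frame_foldl (I := []) (R := [10]) (l := [.rconst 10 0]) s₁
  have h11 : s₁.reg 11 = t := (hF₁.2 11 (by decide)).trans ((hF.2 11 (by decide)).trans ht)
  refine .seq (.block (.seq ?_))
  have hy₂ : HoldsAt (base + n * (d + 1) + d) (0 : Euc d)
      ([Instr.rconst 10 0].foldl (fun s i => i.exec s) s₁) := hy.congr fun j _ => by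
    change s₁.mem _ = _
    rw [hm₁]
    rfl
  refine (reaches_sumPass (hE₁.of_frame_of_mem_eq hF₂ rfl) hX₁ hy₂
    (by simp [Instr.exec])).mono le_rfl ?_
  rintro s₃ ⟨h11₃, h10₃, hy₃, hE₃, hX₃⟩
  refine (reaches_updateProg hsep hE₃ hX₃ hy₃).mono le_rfl ?_
  rintro s₄ ⟨h11₄, hy₄, hE₄, hX₄⟩
  rw [hF₂.2 11 (by decide), h11] at h11₃
  rw [hF₂.2 5 (by decide)] at h10₃ hX₄
  refine ⟨hE₄, ?_, hy₄, by rw [h11₄, h11₃]; push_cast; rfl⟩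
  rw [centerSeq, target_active_eq hη hη1 hr hinj hQ hle hv']
  rwa [h11₃, h10₃] at hX₄

open Classical in
lemma reaches_checkPass {s : State} {x : Euc d} (h : Env n base q η M s) (hx : HoldsAt 0 x s)
    (hc : s.idx 11 = 1) :
    Reaches (passProg checkBody) s (n * (8 * d + 14) + 3) fun s' =>
      s'.idx 11 = (if ∀ i < n, dist x (q i).1 ^ 2 ≤
        ((if (q i).2 ≤ M then 1 + η else 1 + η / 4) * (q i).2) ^ 2 then 1 else 0) ∧
      Env n base q η M s' ∧ HoldsAt 0 x s' := by
  refine (reaches_passProg (c := 6) (fun k s' => s'.idx 11 = (if ∀ i < k, dist x (q i).1 ^ 2 ≤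
    ((if (q i).2 ≤ M then 1 + η else 1 + η / 4) * (q i).2) ^ 2 then 1 else 0))
    h hx ?_ ?_ ?_).mono le_rfl fun _ h => h
  · simp [hc]
  · intro k s₁ s₂ h11 hF' _
    rw [hF'.1 11 (by decide), h11]
  · intro k hk s₁ h11 hE hX h8 h6 h7
    rw [show 6 = 1 + (1 + 1 + (1 + (1 + 1))) by rfl]
    refine .seq (.block (.seq ?_))
    have hF₁ := frame_foldl (I := []) (R := [8]) (l := [.rmul 8 13 7]) s₁
    have hE₁ := hE.of_frame_of_mem_eq hF₁ rfl
    have h81 : ([Instr.rmul 8 13 7].foldl (fun s i => i.exec s) s₁).reg 8 = (1 + η) * (q k).2 := by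
      simp [Instr.exec, hE.r13, h7]
    have hm₁ : ([Instr.rmul 8 13 7].foldl (fun s i => i.exec s) s₁).mem = s₁.mem := rfl
    generalize [Instr.rmul 8 13 7].foldl (fun s i => i.exec s) s₁ = s₂ at hF₁ hE₁ h81 hm₁ ⊢
    have h72 : s₂.reg 7 = (q k).2 := (hF₁.2 7 (by decide)).trans h7
    refine Reaches.mono (T := 1 + 1) (post := fun s' => Frame [] [8] s₁ s' ∧ s'.mem = s₁.mem ∧
      s'.reg 8 = (if (q k).2 ≤ M then 1 + η else 1 + η / 4) * (q k).2)
      (.cond (fun hb => .block ?_) fun hb => .skip ?_) le_rfl ?_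
    · rw [Test.Holds, hE₁.r4, h72] at hb
      refine ⟨hF₁.foldl, hm₁, ?_⟩
      rw [if_neg (not_le.2 hb)]
      simp [Instr.exec, hE₁.r14, h72]
    · rw [Test.Holds, hE₁.r4, h72] at hb
      exact ⟨hF₁, hm₁, by rw [if_pos (not_lt.1 hb), h81]⟩
    rintro s₃ ⟨hF₃, hm₃, h83⟩
    refine .seq (.block ?_)
    have hF₄ := hF₃.foldl (l := [.rmul 8 8 8])
    have h84 : ([Instr.rmul 8 8 8].foldl (fun s i => i.exec s) s₃).reg 8 =
        ((if (q k).2 ≤ M then 1 + η else 1 + η / 4) * (q k).2) ^ 2 := by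
      rw [sq, ← h83]
      simp [Instr.exec]
    have hm₄ : ([Instr.rmul 8 8 8].foldl (fun s i => i.exec s) s₃).mem = s₁.mem := hm₃
    generalize [Instr.rmul 8 8 8].foldl (fun s i => i.exec s) s₃ = s₄ at hF₄ h84 hm₄ ⊢
    have hE₄ := hE.of_frame_of_mem_eq hF₄ hm₄
    have hX₄ : HoldsAt 0 x s₄ := hX.congr fun _ _ => by rw [hm₄]
    have h64 : s₄.reg 6 = dist x (q k).1 ^ 2 := (hF₄.2 6 (by decide)).trans h6
    have h114 : s₄.idx 11 = s₁.idx 11 := hF₄.1 11 (by decide)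
    have h74 := hF₄.1 7 (by decide)
    have h8i := hF₄.1 8 (by decide)
    refine .cond (fun hb => .block ?_) fun hb => .skip ?_
    · rw [Test.Holds, h84, h64] at hb
      have hF₅ := frame_foldl (I := [11]) (R := []) (l := [.iconst 11 0]) s₄
      refine ⟨?_, hE₄.of_frame_of_mem_eq hF₅ rfl, hX₄, (hF₅.1 7 (by decide)).trans h74,
        (hF₅.1 8 (by decide)).trans h8i⟩
      rw [if_neg fun h => absurd (h k k.lt_succ_self) (not_le.2 hb)]
      simp [Instr.exec]
    · rw [Test.Holds, h84, h64, not_lt] at hb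
      refine ⟨?_, hE₄, hX₄, h74, h8i⟩
      rw [h114, h11]
      refine if_congr ⟨fun h i hi => ?_, fun h i hi => h i (by omega)⟩ rfl rfl
      rcases Nat.lt_succ_iff_lt_or_eq.1 hi with hi | rfl
      exacts [h i hi, hb]

lemma reaches_mainProg {Q : Finset (Euc d × ℝ)} (hη : 0 < η) (hη1 : η ≤ 1)
    (hr : ∀ p ∈ Q, 0 < p.2)
    (hinj : Set.InjOn q (Finset.range n)) (hQ : ∀ p, p ∈ Q ↔ ∃ i < n, q i = p)
    (hsep : n = 0 ∨ d ≤ base) {s : State} (h : Env n base q η (cutoff η Q) s)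
    (hx : HoldsAt 0 (0 : Euc d) s) (hy : HoldsAt (base + n * (d + 1) + d) (0 : Euc d) s) :
    Reaches mainProg s
      (⌈65536 / η ^ 4⌉₊ * (n * (24 * d + 32) + 11 * d + 16) + n * (8 * d + 14) + 7) fun s' =>
      (s'.idx 0 ≠ 0 ↔ Accepted η Q (approxCenter η Q)) ∧ HoldsAt 0 (approxCenter η Q) s' := by
  classical
  rw [show ⌈65536 / η ^ 4⌉₊ * (n * (24 * d + 32) + 11 * d + 16) + n * (8 * d + 14) + 7 =
    1 + (⌈65536 / η ^ 4⌉₊ * (n * (24 * d + 32) + 11 * d + 15 + 1) + 1 +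
      (1 + (n * (8 * d + 14) + 3 + 1))) by ring]
  refine .seq (.block (.seq ?_))
  refine Reaches.mono (Reaches.loop (fun t s' => Env n base q η (cutoff η Q) s' ∧
      HoldsAt 0 (centerSeq (1 + η / 2) (active η Q) t : Euc d) s' ∧
      HoldsAt (base + n * (d + 1) + d) (0 : Euc d) s' ∧ s'.reg 11 = t) ?_ ?_ ?_) le_rfl ?_
  · rintro t ht s' ⟨hE, hX, hY, h11⟩
    refine ⟨?_, reaches_stepProg hη hη1 hr hinj hQ hsep hE hX hY h11⟩
    rw [Test.Holds, h11, hE.r12]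
    exact Nat.lt_ceil.1 ht
  · rintro s' ⟨hE, hX, hY, h11⟩
    rw [Test.Holds, h11, hE.r12, not_lt]
    exact Nat.le_ceil _
  · have hF := frame_foldl (I := []) (R := [11]) (l := [.rconst 11 0]) s
    exact ⟨h.of_frame_of_mem_eq hF rfl, hx, hy, by simp [Instr.exec]⟩
  · rintro s₁ ⟨hE, hX, -, -⟩
    have hF := frame_foldl (I := [11]) (R := []) (l := [.iconst 11 1]) s₁
    refine .seq (.block (.seq ?_))
    refine (reaches_checkPass (hE.of_frame_of_mem_eq hF rfl) hX
      (by simp [Instr.exec])).mono le_rfl ?_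
    rintro s₂ ⟨h11, hE₂, hX₂⟩
    refine .block ⟨?_, hX₂⟩
    have : ([Instr.iadd 0 11 12].foldl (fun s i => i.exec s) s₂).idx 0 = s₂.idx 11 := by
      simp [Instr.exec, hE₂.i12]
    rw [this, h11, ite_ne_right_iff]
    simp only [ne_eq, one_ne_zero, not_false_eq_true, and_true]
    refine ⟨fun h p hp => ?_, fun h i hi => h _ ((hQ _).2 ⟨i, hi, rfl⟩)⟩
    obtain ⟨i, hi, rfl⟩ := (hQ p).1 hp
    exact h i hi

end Correctness

/-! ### Input format and initialization -/

section Initialization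

lemma getD_flatMap {α : Type*} (l : List α) (f : α → List ℝ) {L : ℕ} (hf : ∀ a, (f a).length = L)
    (a₀ : α) {i j : ℕ} (hi : i < l.length) (hj : j < L) :
    (l.flatMap f).getD (i * L + j) 0 = (f (l.getD i a₀)).getD j 0 := by
  induction l generalizing i with
  | nil => simp at hi
  | cons a l ih =>
    rw [List.flatMap_cons]
    rcases i with _ | i
    · rw [List.getD_append _ _ _ _ (by rw [hf]; omega)]
      simp
    · rw [Nat.add_one_mul, List.getD_append_right _ _ _ _ (by rw [hf]; omega), hf,
        show i * L + L + j - L = i * L + j by omega, ih (by simpa using hi)]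
      simp

lemma length_flatMap_of_length_eq {α : Type*} (l : List α) (f : α → List ℝ) {L : ℕ}
    (hf : ∀ a, (f a).length = L) : (l.flatMap f).length = l.length * L := by
  simp [List.length_flatMap, hf]

variable {d : ℕ} (lP : List (Euc d)) (lQ : List (Euc d × ℝ)) (η : ℝ)

lemma inputState_mem_record {i j : ℕ} (hi : i < lQ.length) (hj : j < d + 1) :
    (inputState lP lQ η).mem (lP.length * d + i * (d + 1) + j) =
      ((List.ofFn fun j => (lQ.getD i (0, 0)).1 j) ++ [(lQ.getD i (0, 0)).2]).getD j 0 := by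
  have hl := length_flatMap_of_length_eq lP (fun p => List.ofFn fun j => p j) (L := d) (by simp)
  simp only [inputState]
  rw [List.getD_append_right _ _ _ _ (by rw [hl]; omega), hl,
    show lP.length * d + i * (d + 1) + j - lP.length * d = i * (d + 1) + j by omega,
    getD_flatMap lQ _ (by simp) (0, 0) hi hj]

lemma inputState_mem_point {i : ℕ} (hi : i < lQ.length) (j : Fin d) :
    (inputState lP lQ η).mem (lP.length * d + i * (d + 1) + j) = (lQ.getD i (0, 0)).1 j := by
  rw [inputState_mem_record lP lQ η hi (by omega), List.getD_append _ _ _ _ (by simp)]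
  simp

lemma inputState_mem_radius {i : ℕ} (hi : i < lQ.length) :
    (inputState lP lQ η).mem (lP.length * d + i * (d + 1) + d) = (lQ.getD i (0, 0)).2 := by
  rw [inputState_mem_record lP lQ η hi (by omega), List.getD_append_right _ _ _ _ (by simp)]
  simp

lemma inputState_mem_eq_zero {a : ℕ} (ha : lP.length * d + lQ.length * (d + 1) ≤ a) :
    (inputState lP lQ η).mem a = 0 := by
  refine List.getD_eq_default _ _ ?_
  rw [List.length_append, length_flatMap_of_length_eq lP _ (L := d) (by simp),
    length_flatMap_of_length_eq lQ _ (L := d + 1) (by simp)]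
  exact ha

variable {lP lQ η}

lemma reaches_initProg {Q : Finset (Euc d × ℝ)}
    (hQ : ∀ p, p ∈ Q ↔ ∃ i < lQ.length, lQ.getD i (0, 0) = p)
    (hsep : lQ.length = 0 ∨ d ≤ lP.length * d) :
    Reaches initProg (inputState lP lQ η) (3 * lP.length + 3 * d + 8 * lQ.length + 30) fun s =>
      Env lQ.length (lP.length * d) (fun i => lQ.getD i (0, 0)) (min η 1) (cutoff (min η 1) Q) s ∧
      HoldsAt 0 (0 : Euc d) s ∧
      HoldsAt (lP.length * d + lQ.length * (d + 1) + d) (0 : Euc d) s := by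
  set n := lQ.length with hn
  set base := lP.length * d with hbase
  set q : ℕ → Euc d × ℝ := fun i => lQ.getD i (0, 0)
  set s₀ := inputState lP lQ η
  have hi : ∀ a, 3 ≤ a → s₀.idx a = 0 := fun a ha =>
    List.getD_eq_default _ _ (by simpa using ha)
  have hg : ∀ a, 1 ≤ a → s₀.reg a = 0 := fun a ha =>
    List.getD_eq_default _ _ (by simpa using ha)
  rw [show 3 * lP.length + 3 * d + 8 * n + 30 = 3 + (1 + 1 + (lP.length * (2 + 1) + 1 +
    (d * (2 + 1) + 1 + (4 + (n * (2 + (1 + 1 + 2) + 1) + 1 + 15))))) + (n + 3) by ring]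
  refine Reaches.mono (.seq (.block ?_)) (Nat.le_add_right _ _) fun _ h => h
  have hF₁ := frame_foldl (I := [3, 5]) (R := [1]) (l := [.iconst 3 1, .iadd 5 0 3, .rconst 1 1]) s₀
  have hi₁ : ([Instr.iconst 3 1, .iadd 5 0 3, .rconst 1 1].foldl
      (fun s i => i.exec s) s₀).idx 5 = d + 1 ∧ ([Instr.iconst 3 1, .iadd 5 0 3, .rconst 1 1].foldl
      (fun s i => i.exec s) s₀).idx 3 = 1 ∧ ([Instr.iconst 3 1, .iadd 5 0 3, .rconst 1 1].foldl
      (fun s i => i.exec s) s₀).reg 1 = 1 := by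
    simp [Instr.exec, s₀, inputState]
  have hm₁ : ([Instr.iconst 3 1, .iadd 5 0 3, .rconst 1 1].foldl
      (fun s i => i.exec s) s₀).mem = s₀.mem := rfl
  generalize [Instr.iconst 3 1, .iadd 5 0 3, .rconst 1 1].foldl
      (fun s i => i.exec s) s₀ = s₁ at hF₁ hi₁ hm₁ ⊢
  obtain ⟨h5, h3, hr1⟩ := hi₁
  have h0 : s₁.idx 0 = d := hF₁.1 0 (by decide)
  have h1 : s₁.idx 1 = lP.length := hF₁.1 1 (by decide)
  have h2 : s₁.idx 2 = n := hF₁.1 2 (by decide)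
  have h4 : s₁.idx 4 = 0 := (hF₁.1 4 (by decide)).trans (hi 4 (by norm_num))
  have h7 : s₁.idx 7 = 0 := (hF₁.1 7 (by decide)).trans (hi 7 (by norm_num))
  have h9 : s₁.idx 9 = 0 := (hF₁.1 9 (by decide)).trans (hi 9 (by norm_num))
  have h12 : s₁.idx 12 = 0 := (hF₁.1 12 (by decide)).trans (hi 12 (by norm_num))
  have hr0 : s₁.reg 0 = η := hF₁.2 0 (by decide)
  have hr15 : s₁.reg 15 = 0 := (hF₁.2 15 (by decide)).trans (hg 15 (by norm_num))
  refine .seq (Reaches.mono (T := 1 + 1) (post := fun s => Frame [] [0] s₁ s ∧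
    s.mem = s₀.mem ∧ s.reg 0 = min η 1) (.cond (fun hb => .block ?_) fun hb => .skip ?_) le_rfl ?_)
  · rw [Test.Holds, hr1, hr0] at hb
    exact ⟨frame_foldl s₁, hm₁, by simp [Instr.exec, min_eq_right hb.le]⟩
  · rw [Test.Holds, hr1, hr0, not_lt] at hb
    exact ⟨Frame.refl _ _ _, hm₁, by rw [hr0, min_eq_left hb]⟩
  rintro s₂ ⟨hF₂, hm₂, hr0₂⟩
  refine .seq (Reaches.mono (Reaches.loop (fun k s => Frame [4, 7] [0] s₁ s ∧
    s.mem = s₀.mem ∧ s.reg 0 = min η 1 ∧ s.idx 7 = k ∧ s.idx 4 = k * d) ?_ ?_ ?_) le_rfl ?_)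
  · rintro k hk s ⟨hF, hm, hr, h7, h4⟩
    refine ⟨?_, .block ⟨hF.foldl, hm, ?_, ?_, ?_⟩⟩
    · rwa [Test.Holds, h7, hF.1 1 (by decide), h1]
    · simpa [Instr.exec] using hr
    · simp [Instr.exec, h7, hF.1 3 (by decide), h3]
    · simp [Instr.exec, h4, hF.1 0 (by decide), h0]
      ring
  · rintro s ⟨hF, hm, hr, h7, h4⟩
    rw [Test.Holds, h7, hF.1 1 (by decide), h1]
    exact lt_irrefl _
  · exact ⟨(Frame.refl [] [] s₁).trans hF₂, hm₂, hr0₂, (hF₂.1 7 (by decide)).trans h7,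
      by rw [hF₂.1 4 (by decide), h4]; simp⟩
  rintro s₃ ⟨hF₃, hm₃, hr₃, -, h4₃⟩
  refine .seq (Reaches.mono (Reaches.loop (fun k s => Frame [4, 7, 9] [0] s₁ s ∧
    s.reg 0 = min η 1 ∧ s.idx 4 = base ∧ s.idx 9 = k ∧ (∀ j < k, s.mem j = 0) ∧
    ∀ j, k ≤ j → s.mem j = s₀.mem j) ?_ ?_ ?_) le_rfl ?_)
  · rintro k hk s ⟨hF, hr, h4, h9, hz, hm⟩
    refine ⟨?_, .block ⟨hF.foldl, ?_, ?_, ?_, ?_, ?_⟩⟩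
    · rwa [Test.Holds, h9, hF.1 0 (by decide), h0]
    · simpa [Instr.exec] using hr
    · simpa [Instr.exec] using h4
    · simp [Instr.exec, h9, hF.1 3 (by decide), h3]
    · intro j hj
      rcases Nat.lt_succ_iff_lt_or_eq.1 hj with hj | rfl
      · simp [Instr.exec, h9, hz j hj, hj.ne]
      · simp [Instr.exec, h9, hF.2 15 (by decide), hr15]
    · intro j hj
      simp [Instr.exec, h9, hm j (by omega), show j ≠ k by omega]
  · rintro s ⟨hF, -, -, h9, -⟩
    rw [Test.Holds, h9, hF.1 0 (by decide), h0]
    exact lt_irrefl _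
  · exact ⟨(Frame.refl [] [] s₁).trans hF₃, hr₃, h4₃, (hF₃.1 9 (by decide)).trans h9, by simp,
      fun j _ => by rw [hm₃]⟩
  rintro s₄ ⟨hF₄, hr₄, h4₄, -, hz₄, hm₄⟩
  have hpoint : ∀ i < n, ∀ j : Fin d, s₄.mem (base + i * (d + 1) + j) = (q i).1 j :=
    fun i hi j => by
      rw [hm₄ _ (by rcases hsep with h | h <;> omega)]
      exact inputState_mem_point lP lQ η hi j
  have hradius : ∀ i < n, s₄.mem (base + i * (d + 1) + d) = (q i).2 := fun i hi => by
    rw [hm₄ _ (by omega)]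
    exact inputState_mem_radius lP lQ η hi
  refine .seq (.block (.seq ?_))
  refine Reaches.mono (Reaches.loop (fun k s => Frame [4, 7, 8, 9, 10] [0, 3, 7] s₁ s ∧
    s.mem = s₄.mem ∧ s.reg 0 = min η 1 ∧ s.idx 4 = base ∧ s.idx 7 = k ∧
    s.idx 8 = base + k * (d + 1) ∧ (∀ i < k, s.reg 3 ≤ (q i).2) ∧
    (s.reg 3 = s₄.mem (base + d) ∨ ∃ i < k, s.reg 3 = (q i).2)) ?_ ?_ ?_) le_rfl ?_
  · rintro k hk s ⟨hF, hm, hr, h4, h7, h8, hle, hv⟩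
    refine ⟨by rwa [Test.Holds, h7, hF.1 2 (by decide), h2], ?_⟩
    have hF' := hF.foldl (l := [.iadd 10 8 0, .rload 7 10])
    have h7' : ([Instr.iadd 10 8 0, .rload 7 10].foldl (fun s i => i.exec s) s).reg 7 =
        (q k).2 := by
      simp [Instr.exec, h8, hm, hF.1 0 (by decide), h0, hradius k hk]
    have h3' : ([Instr.iadd 10 8 0, .rload 7 10].foldl (fun s i => i.exec s) s).reg 3 =
        s.reg 3 := by
      simp [Instr.exec]
    have hr' : ([Instr.iadd 10 8 0, .rload 7 10].foldl (fun s i => i.exec s) s).reg 0 =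
        s.reg 0 := by
      simp [Instr.exec]
    have hm' : ([Instr.iadd 10 8 0, .rload 7 10].foldl (fun s i => i.exec s) s).mem = s.mem := rfl
    have hix : ∀ a, a ≠ 10 → ([Instr.iadd 10 8 0, .rload 7 10].foldl
        (fun s i => i.exec s) s).idx a = s.idx a := fun a ha => by simp [Instr.exec, ha]
    refine .seq (.block ?_)
    generalize [Instr.iadd 10 8 0, .rload 7 10].foldl (fun s i => i.exec s) s = u
      at hF' h7' h3' hr' hm' hix ⊢
    have hmin : Reaches (.cond (.rlt 7 3) (block [.radd 3 7 15]) .skip) u (1 + 1) fun w =>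
      Frame [4, 7, 8, 9, 10] [0, 3, 7] s₁ w ∧ w.mem = s₄.mem ∧ w.reg 0 = min η 1 ∧
      w.idx 4 = base ∧ w.idx 7 = k ∧ w.idx 8 = base + k * (d + 1) ∧
      (∀ i < k + 1, w.reg 3 ≤ (q i).2) ∧
      (w.reg 3 = s₄.mem (base + d) ∨ ∃ i < k + 1, w.reg 3 = (q i).2) := by
      refine .cond (fun hb => .block ?_) fun hb => .skip ?_
      · rw [Test.Holds, h7', h3'] at hb
        have e : ([Instr.radd 3 7 15].foldl (fun s i => i.exec s) u).reg 3 = (q k).2 := by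
          simp [Instr.exec, h7', hF'.2 15 (by decide), hr15]
        refine ⟨hF'.foldl, hm'.trans hm, ?_, ?_, ?_, ?_, fun i hi => ?_, ?_⟩
        · simp [Instr.exec, hr', hr]
        · exact (hix 4 (by decide)).trans h4
        · exact (hix 7 (by decide)).trans h7
        · exact (hix 8 (by decide)).trans h8
        · rw [e]
          rcases Nat.lt_succ_iff_lt_or_eq.1 hi with hi | rfl
          · exact hb.le.trans (hle i hi)
          · exact le_rfl
        · exact .inr ⟨k, by omega, e⟩
      · rw [Test.Holds, h7', h3', not_lt] at hb
        refine ⟨hF', hm'.trans hm, hr'.trans hr, (hix 4 (by decide)).trans h4,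
          (hix 7 (by decide)).trans h7, (hix 8 (by decide)).trans h8, fun i hi => ?_, ?_⟩
        · rw [h3']
          rcases Nat.lt_succ_iff_lt_or_eq.1 hi with hi | rfl
          · exact hle i hi
          · exact hb
        · rw [h3']
          exact hv.imp_right fun ⟨i, hi, hv⟩ => ⟨i, by omega, hv⟩
    change Reaches _ _ (1 + 1 + 2) _
    refine .seq (hmin.mono le_rfl ?_)
    rintro w ⟨hFw, hmw, hrw, h4w, h7w, h8w, hlew, hvw⟩
    refine .block ⟨hFw.foldl, hmw, hrw, ?_, ?_, ?_, hlew, hvw⟩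
    · simp [Instr.exec, h4w]
    · simp [Instr.exec, h7w, hFw.1 3 (by decide), h3]
    · simp [Instr.exec, h8w, hFw.1 5 (by decide), h5]
      ring
  · rintro s ⟨hF, -, -, -, h7, -⟩
    rw [Test.Holds, h7, hF.1 2 (by decide), h2]
    exact lt_irrefl _
  · have hF := frame_foldl (I := [7, 8, 10]) (R := [3])
      (l := [.iadd 8 4 12, .iadd 10 8 0, .rload 3 10, .iconst 7 0]) s₄
    refine ⟨hF₄.trans hF, rfl, ?_, ?_, ?_, ?_, by simp, .inl ?_⟩
    · simpa [Instr.exec] using hr₄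
    · simpa [Instr.exec] using h4₄
    · simp [Instr.exec]
    · simp [Instr.exec, h4₄, hF₄.1 12 (by decide), h12]
    · simp [Instr.exec, h4₄, hF₄.1 12 (by decide), h12, hF₄.1 0 (by decide), h0]
  · rintro s ⟨hF, hm, hr, h4, -, h8, hle, hv⟩
    have h3m : s.reg 3 = minRadius Q := by
      rcases Nat.eq_zero_or_pos n with hn0 | hpos
      · have hQ0 : Q = ∅ := Finset.eq_empty_of_forall_notMem fun p hp => by
          obtain ⟨i, hi, -⟩ := (hQ p).1 hp
          omega
        rcases hv with hv | ⟨i, hi, -⟩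
        -- The address of the first radius is then beyond the end of the input.
        · rw [hv, hQ0, hm₄ _ (by omega), inputState_mem_eq_zero lP lQ η (by rw [← hn, hn0]; omega)]
          simp [minRadius]
        · omega
      · have : ∃ i < n, s.reg 3 = (q i).2 := by
          rcases hv with hv | hv
          · refine ⟨0, hpos, ?_⟩
            have := hradius 0 hpos
            rw [Nat.zero_mul, Nat.add_zero] at this
            rw [hv, this]
          · exact hv
        obtain ⟨i, hi, e⟩ := this
        have hiQ := (hQ (q i)).2 ⟨i, hi, rfl⟩
        obtain ⟨p, hp, hpm⟩ := exists_eq_minRadius ⟨_, hiQ⟩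
        obtain ⟨j, hj, rfl⟩ := (hQ p).1 hp
        exact le_antisymm (hpm ▸ hle j hj) (e ▸ minRadius_le hiQ)
    refine .block ⟨⟨?_, ?_, ?_, ?_, ?_, ?_, ?_, ?_, ?_, ?_, ?_, ?_, ?_, ?_, ?_, ?_⟩, ?_, ?_⟩
    · simp [Instr.exec, hF.1 0 (by decide), h0]
    · simp [Instr.exec, hF.1 2 (by decide), h2]
    · simp [Instr.exec, hF.1 3 (by decide), h3]
    · simp [Instr.exec, h4]
    · simp [Instr.exec, hF.1 5 (by decide), h5]
    · simp [Instr.exec, hF.1 0 (by decide), h0, h8]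
    · simp [Instr.exec, hF.1 12 (by decide), h12]
    · simp [Instr.exec, hF.2 1 (by decide), hr1]
    · simp [Instr.exec, hF.2 1 (by decide), hr1, hr]
    · simp [Instr.exec, hr, h3m, cutoff]
    · simp [Instr.exec, hr]
      ring
    · simp [Instr.exec, hF.2 1 (by decide), hr1, hr]
    · simp [Instr.exec, hF.2 1 (by decide), hr1, hr]
    · simp [Instr.exec, hF.2 15 (by decide), hr15]
    · intro i hi j
      change s.mem _ = _
      rw [hm]
      exact hpoint i hi j
    · intro i hi
      change s.mem _ = _
      rw [hm]
      exact hradius i hi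
    · intro j
      change s.mem _ = _
      rw [hm, hz₄ _ (by omega)]
      rfl
    · intro j
      change s.mem _ = _
      rw [hm, hm₄ _ (by omega),
        inputState_mem_eq_zero lP lQ η (by rw [← hn, ← hbase]; omega)]
      rfl

end Initialization

/-! ### Polynomial running time -/

section Main

lemma reaches_ballProg {d : ℕ} {P : Finset (Euc d)} {Q : Finset (Euc d × ℝ)} {η : ℝ}
    (hI : IsInstance P Q) (hη : 0 < η) {lP : List (Euc d)} {lQ : List (Euc d × ℝ)}
    (hlP : ∀ p, p ∈ lP ↔ p ∈ P) (hnd : lQ.Nodup) (hlQ : ∀ q, q ∈ lQ ↔ q ∈ Q) :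
    Reaches ballProg (inputState lP lQ η)
      (3 * lP.length + 3 * d + 8 * lQ.length + 30 + (⌈65536 / min η 1 ^ 4⌉₊ *
        (lQ.length * (24 * d + 32) + 11 * d + 16) + lQ.length * (8 * d + 14) + 7))
      fun s => outputOf d s = centerRule d P Q η := by
  have hQ : ∀ p, p ∈ Q ↔ ∃ i < lQ.length, lQ.getD i (0, 0) = p := fun p => by
    rw [← hlQ, List.mem_iff_getElem]
    refine ⟨fun ⟨i, hi, h⟩ => ⟨i, hi, ?_⟩, fun ⟨i, hi, h⟩ => ⟨i, hi, ?_⟩⟩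
    · rw [List.getD_eq_getElem _ _ hi, h]
    · rw [← h, List.getD_eq_getElem _ _ hi]
  have hinj : Set.InjOn (fun i => lQ.getD i (0, 0)) (Finset.range lQ.length) := by
    intro i hi j hj h
    simp only [Finset.coe_range, Set.mem_Iio] at hi hj
    simp only [List.getD_eq_getElem _ _ hi, List.getD_eq_getElem _ _ hj] at h
    exact (hnd.getElem_inj_iff).1 h
  have hsep : lQ.length = 0 ∨ d ≤ lP.length * d := by
    rcases lQ with _ | ⟨q, lQ⟩
    · exact .inl rfl
    · have hq := (hI q ((hlQ q).1 (by simp))).1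
      have := List.length_pos_of_mem ((hlP _).2 hq)
      exact .inr (Nat.le_mul_of_pos_left _ this)
  refine .seq ((reaches_initProg hQ hsep).mono le_rfl ?_)
  rintro s ⟨hE, hX, hY⟩
  refine (reaches_mainProg (lt_min hη one_pos) (min_le_right _ _) (fun p hp => (hI p hp).2) hinj hQ
    hsep hE hX hY).mono le_rfl ?_
  rintro s' ⟨hacc, hX'⟩
  unfold outputOf centerRule
  by_cases h : Accepted (min η 1) Q (approxCenter (min η 1) Q)
  · rw [if_neg (hacc.2 h), if_pos h]
    congr 1
    ext j
    have := hX' j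
    rw [Nat.zero_add] at this
    exact this
  · rw [if_pos (not_not.1 fun h' => h (hacc.1 h')), if_neg h]

lemma steps_le {p d n : ℕ} {η : ℝ} (hη : 0 < η) :
    ((3 * p + 3 * d + 8 * n + 30 + (⌈65536 / min η 1 ^ 4⌉₊ *
      (n * (24 * d + 32) + 11 * d + 16) + n * (8 * d + 14) + 7) : ℕ) : ℝ) ≤
      6000000 * (1 + d + p + n + 1 / η) ^ 6 := by
  set X : ℝ := 1 + d + p + n + 1 / η with hX
  have hη' : 0 < 1 / η := by positivity
  have hd : (0 : ℝ) ≤ d := Nat.cast_nonneg d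
  have hp : (0 : ℝ) ≤ p := Nat.cast_nonneg p
  have hn : (0 : ℝ) ≤ n := Nat.cast_nonneg n
  have hX1 : 1 ≤ X := by linarith
  have hinv : 1 / min η 1 ≤ X := by
    rcases min_choice η 1 with h | h <;> rw [h] <;> linarith
  have hmin : 0 < min η 1 := lt_min hη one_pos
  have hT : (⌈65536 / min η 1 ^ 4⌉₊ : ℝ) ≤ 65537 * X ^ 4 := by
    have h1 := (Nat.ceil_lt_add_one (show 0 ≤ 65536 / min η 1 ^ 4 by positivity)).le
    have h2 : 65536 / min η 1 ^ 4 = 65536 * (1 / min η 1) ^ 4 := by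
      rw [one_div, inv_pow, div_eq_mul_inv]
    have h3 := pow_le_pow_left₀ (by positivity) hinv 4
    linarith [one_le_pow₀ hX1 (n := 4)]
  have hX2 : X ≤ X ^ 2 := le_self_pow₀ hX1 two_ne_zero
  have hnd : (n : ℝ) * d ≤ X ^ 2 := by
    rw [sq]
    exact mul_le_mul (by linarith) (by linarith) hd (by linarith)
  have hbody : (n : ℝ) * (24 * d + 32) + 11 * d + 16 ≤ 83 * X ^ 2 := by linarith
  have h26 : X ^ 2 ≤ X ^ 6 := pow_le_pow_right₀ hX1 (by norm_num)
  have hprod := mul_le_mul hT hbody (by positivity) (by positivity)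
  rw [show 65537 * X ^ 4 * (83 * X ^ 2) = 5439571 * X ^ 6 by ring] at hprod
  push_cast
  linarith

lemma isBallIntersectionAlgorithm_centerRule : IsBallIntersectionAlgorithm centerRule where
  sound _ _ _ _ hI hη _ h := centerRule_sound hη (fun p hp => (hI p hp).2) h
  complete _ _ _ _ hI hη h := centerRule_complete hη (fun p hp => (hI p hp).2) h
  polyTime := by
    refine ⟨ballProg, 6000000, fun d P Q η hI hη lP lQ hPn hlP hQn hlQ => ?_⟩
    obtain ⟨s, t, hr, ht, hs⟩ := reaches_ballProg hI hη hlP hQn hlQ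
    refine ⟨s, t, hr, hs, ?_⟩
    have hP : lP.length = P.card := by
      classical
      rw [← List.toFinset_card_of_nodup hPn]
      congr 1
      ext p
      simp [hlP]
    have hQ : lQ.length = Q.card := by
      classical
      rw [← List.toFinset_card_of_nodup hQn]
      congr 1
      ext p
      rw [List.mem_toFinset, hlQ]
    rw [hP, hQ] at ht
    refine ((Nat.cast_le.2 ht).trans (steps_le hη)).trans ?_
    have hX1 : (1 : ℝ) ≤ 1 + d + P.card + Q.card + 1 / η := by
      have : 0 < 1 / η := by positivity
      have : (0 : ℝ) ≤ d + P.card + Q.card := by positivity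
      linarith
    exact mul_le_mul (by norm_num) (pow_le_pow_right₀ hX1 (by norm_num)) (by positivity)
      (Nat.cast_nonneg _)

end Main

end RealRAM

end

theorem theorem1p6 :
    ∃ K : ℝ, 0 < K ∧
      (∀ ε : ℝ, 0 < ε → ε < 1 →
        (algScatterDim ε : ℝ≥0∞) ≤ ENNReal.ofReal (K * (1 / ε) ^ 4 * Real.log (2 / ε))) ∧
      (∃ C : CenterRule, IsBallIntersectionAlgorithm C ∧
        ∀ ε : ℝ, 0 < ε → ε < 1 →
          (scatterDimOf ε C : ℝ≥0∞) ≤ ENNReal.ofReal (K * (1 / ε) ^ 4 * Real.log (2 / ε))) := by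
  have hC := RealRAM.isBallIntersectionAlgorithm_centerRule
  refine ⟨140000, by norm_num, fun ε hε hε1 => ?_, centerRule, hC,
    fun ε hε hε1 => scatterDimOf_centerRule_le hε hε1⟩
  refine le_trans ?_ (scatterDimOf_centerRule_le hε hε1)
  exact ENat.toENNReal_le.2 (iInf₂_le centerRule hC)
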